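/- **Setting.** Consider the cubic lattice $\mathbb Z^3$ with nearest-neighbour edges. Every edge $e$ is dual to the plaquette $f_e$, the closed unit square that perpendicularly bisects $e$. Two distinct plaquettes are 1-connected if their intersection contains a unit line segment. Let $\mathcal U\subset\mathbb Z^3$ be a subgraph; a plaquette $f_e$ is said to be in $\mathcal U$ if $e$ is an edge of $\mathcal U$. For a collection $F$ of plaquettes, $\overline F$ is the set of plaquettes in $\mathcal U$ that are in $F$ or are 1-connected to an element of $F$, and $\partial F=\overline F\setminus F$. A boundary condition $\eta$ declares every edge of $\mathbb Z^3$ that is not an edge of $\mathcal U$ open or closed. For finite $\mathcal U$, $p=1-e^{-\beta}$ and $\omega\in\{0,1\}^{E(\mathcal U)}$ (value $1$ meaning open), let $\kappa^\eta(\omega)$ be the number of connected components of the graph formed by the open edges of $\omega$ and of $\eta$ that contain a vertex of $\mathcal U$, and let $$Z^\eta(\mathcal U)=\sum_{\omega}p^{|\omega|}(1-p)^{|E(\mathcal U)|-|\omega|}q^{\kappa^\eta(\omega)},\qquad \pi^\eta_{\mathcal U}(\omega)=\frac{p^{|\omega|}(1-p)^{|E(\mathcal U)|-|\omega|}q^{\kappa^\eta(\omega)}}{Z^\eta(\mathcal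 U)},$$ where $|\omega|$ is the number of open edges of $\omega$. The wired boundary condition $\mathsf w$ is the one in which every edge outside $\mathcal U$ is open. For a set $F$ of plaquettes in $\mathcal U$, let $\mathsf{Cl}(F)$ be the event that $\omega_e=0$ for all $f_e\in F$ and $\omega_e=1$ for all $f_e\in\partial F$, and let $\kappa(F)$ be the number of connected components of $\mathcal U$ after removing the edges $e$ with $f_e\in F$, where vertices joined by open edges of $\eta$ outside $\mathcal U$ are viewed as connected. A set $F$ of plaquettes in $\mathcal U$ is *compatible* for $(\mathcal U,\eta)$ if, for every plaquette $f_e$ with $e\notin E(\mathcal U)$ and $\eta_e=0$, every plaquette in $\mathcal U$ that is 1-connected to $f_e$ belongs to $\overline F$. **Proposition.** There is a constant $K>0$ such that for every real $q\ge1$ there is $\beta_0>0$ such that for every $\beta\ge\beta_0$ there is a function $\mathbf g(f,F,\mathcal U)\in\mathbb R$ of a collection $F$ of plaquettes, a plaquette $f\in F$ and a subgraph $\mathcal U\subset\mathbb Z^3$ (not depending on any boundary condition) with the following properties. 1. For all $F$, $f\in F$ and $\mathcal U\subset\mathbb Z^3$, $\;|\mathbf g(f,F,\mathcal U)|\le e^{-\beta/K}$.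 2. For all $F,F'$, $f\in F$, $f'\in F'$, $\mathcal U,\mathcal U'\subset\mathbb Z^3$, $$|\mathbf g(f,F,\mathcal U)-\mathbf g(f',F',\mathcal U')|\le e^{-\beta r/K}$$ for $r=0$ and for every real $r\ge0$ such that the translation that carries $f$ to $f'$ exists and maps $B_r(f)\cap\mathcal U$ onto $B_r(f')\cap\mathcal U'$ (as graphs) and $B_r(f)\cap F$ onto $B_r(f')\cap F'$. Here $B_r(f)$ is the closed $L_\infty$ ball of radius $r$ about the centre of $f$, and an edge or a plaquette belongs to a ball if its centre does. 3. For every finite subgraph $\mathcal U\subset\mathbb Z^3$ with at least one vertex, every boundary condition $\eta$ and every $F$ compatible for $(\mathcal U,\eta)$, $$\pi_{\mathcal U}^\eta(\mathsf{Cl}(F))=\frac{Z^{\mathsf w}(\mathcal U)}{Z^\eta(\mathcal U)}\,(1-e^{-\beta})^{|\partial F|}\,e^{-\beta|F|}\,q^{\kappa(F)-1}\exp\Big(\sum_{f\in F}\mathbf g(f,F,\mathcal U)\Big).$$ -/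

import Mathlib

/-! Random-cluster model on finite subgraphs of the cubic lattice. -/

noncomputable section

namespace RandomCluster

/-- Sites of the cubic lattice `ℤ³`. -/
abbrev Site : Type := Fin 3 → ℤ

/-- The cubic lattice `ℤ³`, with edges between sites at `ℓ¹`-distance one. -/
def cubicLattice : SimpleGraph Site where
  Adj x y := ∑ i, |x i - y i| = 1
  symm := ⟨fun x y h => by
    rw [← h]; exact Finset.sum_congr rfl fun i _ => abs_sub_comm _ _⟩
  loopless := ⟨fun x h => by simp at h⟩

/-- The four sides of the unit lattice square with lowest corner `x` in directions `i`, `j`. -/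
def squareSides (x : Site) (i j : Fin 3) : Set (Sym2 Site) :=
  {s(x, x + Pi.single i 1), s(x, x + Pi.single j 1),
    s(x + Pi.single i 1, x + Pi.single i 1 + Pi.single j 1),
    s(x + Pi.single j 1, x + Pi.single i 1 + Pi.single j 1)}

/-- Plaquettes (closed unit squares bisecting a lattice edge perpendicularly) are represented
throughout by their dual edges.  Two different plaquettes are 1-connected if they share a unit
segment (a side).  A unit segment of the dual lattice crosses exactly one unit square of the
lattice, and the four plaquettes having this segment as a side are the duals of the four sides of
that square; so two plaquettes are 1-connected iff their dual edges are two sides of a common unit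
square of the lattice. -/
def OneConnected (e e' : Sym2 Site) : Prop :=
  e ≠ e' ∧ ∃ (x : Site) (i j : Fin 3), i ≠ j ∧ e ∈ squareSides x i j ∧ e' ∈ squareSides x i j

/-- `F̄` relative to the domain `U`: the plaquettes of `U` that belong to `F` or are 1-connected
to an element of `F`. -/
def plaqClosure (U : cubicLattice.Subgraph) (F : Set (Sym2 Site)) : Set (Sym2 Site) :=
  {e | e ∈ U.edgeSet ∧ (e ∈ F ∨ ∃ f ∈ F, OneConnected f e)}

/-- `∂F = F̄ \ F`. -/
def plaqBoundary (U : cubicLattice.Subgraph) (F : Set (Sym2 Site)) : Set (Sym2 Site) :=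
  plaqClosure U F \ F

/-- The graph on `ℤ³` formed by the open edges: inside `U` these are given by `ω`, outside `U`
by the boundary condition `η`.  (Configurations and boundary conditions are given by their sets of
open edges; the part of `ω` outside `U` and the part of `η` inside `U` are irrelevant.) -/
def openGraph (U : cubicLattice.Subgraph) (η ω : Set (Sym2 Site)) : SimpleGraph Site :=
  SimpleGraph.fromEdgeSet ((ω ∩ U.edgeSet) ∪ (η ∩ (cubicLattice.edgeSet \ U.edgeSet)))

/-- `κ^η(ω)`: the number of open clusters of `ω` in `U`, where vertices joined by open edges of `η`
outside `U` are viewed as connected; i.e. the number of components of the open graph that contain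
a vertex of `U`. -/
def numClusters (U : cubicLattice.Subgraph) (η ω : Set (Sym2 Site)) : ℕ :=
  ((openGraph U η ω).connectedComponentMk '' U.verts).ncard

/-- The random-cluster weight `p^{#open} (1-p)^{#closed} q^{κ^η(ω)}` of `ω ⊆ E(U)`. -/
def weight (p q : ℝ) (U : cubicLattice.Subgraph) (η ω : Set (Sym2 Site)) : ℝ :=
  p ^ ω.ncard * (1 - p) ^ (U.edgeSet \ ω).ncard * q ^ numClusters U η ω

/-- The partition function `Z^η(U)` for finite `U`. -/
def partitionFunction (p q : ℝ) (U : cubicLattice.Subgraph) (η : Set (Sym2 Site)) : ℝ :=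
  ∑ᶠ ω ∈ {ω : Set (Sym2 Site) | ω ⊆ U.edgeSet}, weight p q U η ω

/-- The probability `π_U^η(A)` of an event `A` under the random-cluster measure on the finite graph
`U` with boundary condition `η`. -/
def prob (p q : ℝ) (U : cubicLattice.Subgraph) (η : Set (Sym2 Site))
    (A : Set (Set (Sym2 Site))) : ℝ :=
  (∑ᶠ ω ∈ {ω : Set (Sym2 Site) | ω ⊆ U.edgeSet ∧ ω ∈ A}, weight p q U η ω) /
    partitionFunction p q U η

/-- The wired boundary condition: every edge of `ℤ³` outside the domain is open. -/
def wired : Set (Sym2 Site) := cubicLattice.edgeSet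

/-- The event `Cl(F)`: the edges dual to `F` are closed, those dual to `∂F` are open. -/
def Cl (U : cubicLattice.Subgraph) (F : Set (Sym2 Site)) : Set (Set (Sym2 Site)) :=
  {ω | (∀ e ∈ F, e ∉ ω) ∧ ∀ e ∈ plaqBoundary U F, e ∈ ω}

/-- `F` is a compatible set of plaquettes for `(U, η)`: every plaquette of `U` that is 1-connected
to a dual-to-closed plaquette of `η` outside `U` belongs to `F̄`. -/
def Compatible (U : cubicLattice.Subgraph) (η F : Set (Sym2 Site)) : Prop :=
  F ⊆ U.edgeSet ∧
    ∀ e ∈ cubicLattice.edgeSet, e ∉ U.edgeSet → e ∉ η →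
      ∀ e' ∈ U.edgeSet, OneConnected e e' → e' ∈ plaqClosure U F

/-- `κ(F)`: the number of components of `U` after removing the edges dual to `F`, where vertices
joined by open edges of `η` outside `U` are viewed as connected. -/
def kappa (U : cubicLattice.Subgraph) (η F : Set (Sym2 Site)) : ℕ :=
  numClusters U η (U.edgeSet \ F)

/-- A site of `ℤ³` as a point of `ℝ³`; `Fin 3 → ℝ` carries the `L_∞` distance. -/
def toReal (v : Site) : Fin 3 → ℝ := fun i => (v i : ℝ)

/-- The centre of a plaquette, which is also the midpoint of its dual edge. -/
def center : Sym2 Site → (Fin 3 → ℝ) :=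
  Sym2.lift ⟨fun x y => (2⁻¹ : ℝ) • (toReal x + toReal y), fun x y =>
    congrArg ((2⁻¹ : ℝ) • ·) (add_comm (toReal x) (toReal y))⟩

/-- Translation of an edge (or of its dual plaquette) by `t`. -/
def translate (t : Site) : Sym2 Site → Sym2 Site := Sym2.map fun x => x + t

/-- `B_r(f) ∩ U ≅ B_r(f') ∩ U'` as graphs and `B_r(f) ∩ F ≅ B_r(f') ∩ F'` as plaquette sets, via
the translation that carries `f` to `f'`.  An edge or a plaquette belongs to a ball if its centre
does. -/
def LocallyCongruent (r : ℝ) (f : Sym2 Site) (F : Set (Sym2 Site)) (U : cubicLattice.Subgraph)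
    (f' : Sym2 Site) (F' : Set (Sym2 Site)) (U' : cubicLattice.Subgraph) : Prop :=
  ∃ t : Site, translate t f = f' ∧
    (∀ v : Site, toReal v ∈ Metric.closedBall (center f) r → (v ∈ U.verts ↔ v + t ∈ U'.verts)) ∧
    ∀ e ∈ cubicLattice.edgeSet, center e ∈ Metric.closedBall (center f) r →
      (e ∈ U.edgeSet ↔ translate t e ∈ U'.edgeSet) ∧ (e ∈ F ↔ translate t e ∈ F')

end RandomCluster

end

/-! A configuration in `Cl U F` is determined by the set D of its closed edges outside the closure
F̄ of F. Compatibility keeps D apart from both F and the closed edges of η. Then D raises the number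
of clusters by a quantity that depends on D alone: the number of components of ℤ³ without D, minus
one. The topological reason is `reachable_cut_union_iff`, which rests on the vanishing of the first
mod 2 cohomology of ℤ³ (`exists_potential`).

With E the edge set of U, the total weight of `Cl U F` is therefore p^(|E|-|F|) (1-p)^|F| q^κ(F) Ξ(E
\ F̄). Here Ξ = `xi` sums `polymerWeight` over subsets, and this weight factorizes over sets that
are not 1-connected to each other. The wired case with F empty gives Z^w = p^|E| q Ξ(E). What
remains is to write Ξ(E \ F̄) / Ξ(E) as the exponential of a sum of local terms.

Remove the plaquettes of F̄ from E one by one in a translation-invariant order. The quotient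
telescopes into inverses of ratios Ξ(Λ) / Ξ(Λ \ e). The logarithm of such a ratio is small and
depends exponentially weakly on Λ far from e (`abs_ratio_sub_le`). This follows by induction on the
distance from the recursion `ratio_eq` over connected sets containing e; no convergent cluster
expansion is needed. The function g (`interaction`) combines these logarithms with -log p and shares
each term equally among the adjacent plaquettes of F. -/

noncomputable section

set_option linter.unusedSectionVars false

/-! ### Abstract polymer weights: recursion for ratios of partition functions and counting of
animals. -/

namespace Polymer

open Finset Relation
open scoped Classical

variable {V : Type*} [DecidableEq V]

/-- The part of `D` that can be reached from `e` by steps within `D` between neighbours. -/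
def compAt (N : V → Finset V) (e : V) (D : Finset V) : Finset V :=
  D.filter fun v => ReflTransGen (fun a b => b ∈ N a ∧ b ∈ D) e v

/-- The connected subsets of `Λ` that contain `e`. -/
def animals (N : V → Finset V) (e : V) (Λ : Finset V) : Finset (Finset V) :=
  Λ.powerset.filter fun γ => e ∈ γ ∧ compAt N e γ = γ

/-- The partition function of the weight `w` on subsets of `Λ`. -/
def xi (w : Finset V → ℝ) (Λ : Finset V) : ℝ := ∑ D ∈ Λ.powerset, w D

/-- The ratio of partition functions with and without the site `e`. -/
def ratio (w : Finset V → ℝ) (e : V) (Λ : Finset V) : ℝ := xi w Λ / xi w (Λ.erase e)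

/-- Weights that factorize over subsets that are not neighbours of one another. -/
structure IsMultiplicative (N : V → Finset V) (w : Finset V → ℝ) : Prop where
  empty : w ∅ = 1
  nonneg : ∀ D, 0 ≤ w D
  union : ∀ γ D, Disjoint D (γ.biUnion N) → w (γ ∪ D) = w γ * w D

/-- A symmetric system of closed neighbourhoods. -/
structure IsNbhd (N : V → Finset V) : Prop where
  self_mem : ∀ e, e ∈ N e
  symm : ∀ a b, a ∈ N b → b ∈ N a

variable {N : V → Finset V} {w : Finset V → ℝ} {M : ℕ}

lemma compAt_subset (e : V) (D : Finset V) : compAt N e D ⊆ D := filter_subset _ _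

lemma self_mem_compAt {e : V} {D : Finset V} (h : e ∈ D) : e ∈ compAt N e D :=
  mem_filter.2 ⟨h, .refl⟩

lemma mem_compAt_of_mem_nbhd {e a b : V} {D : Finset V} (ha : a ∈ compAt N e D) (hb : b ∈ D)
    (hab : b ∈ N a) : b ∈ compAt N e D :=
  mem_filter.2 ⟨hb, (mem_filter.1 ha).2.tail ⟨hab, hb⟩⟩

lemma compAt_compAt {e : V} {D : Finset V} (h : e ∈ D) :
    compAt N e (compAt N e D) = compAt N e D := by
  refine (compAt_subset _ _).antisymm fun v hv => ?_
  have hr := (mem_filter.1 hv).2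
  clear hv
  induction hr with
  | refl => exact self_mem_compAt (self_mem_compAt h)
  | @tail b c hb hbc ih =>
    exact mem_compAt_of_mem_nbhd ih (mem_compAt_of_mem_nbhd (compAt_subset _ _ ih) hbc.2 hbc.1) hbc.1

/-- A step from `γ` into `D` would land in `γ.biUnion N`, so no path leaves `γ`. -/
lemma compAt_union {e : V} {γ D : Finset V} (h : compAt N e γ = γ) (he : e ∈ γ)
    (hD : Disjoint D (γ.biUnion N)) : compAt N e (γ ∪ D) = γ := by
  ext v
  constructor
  · intro hv
    have hr := (mem_filter.1 hv).2
    clear hv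
    induction hr with
    | refl => exact he
    | @tail b c hb hbc ih =>
      refine (mem_union.1 hbc.2).resolve_right fun hc => ?_
      exact disjoint_left.1 hD hc (mem_biUnion.2 ⟨b, ih, hbc.1⟩)
  · intro hv
    rw [← h] at hv
    exact mem_filter.2 ⟨mem_union_left _ (compAt_subset _ _ hv),
      ReflTransGen.mono (fun a b hab => ⟨hab.1, mem_union_left _ hab.2⟩) _ _ (mem_filter.1 hv).2⟩

lemma subset_biUnion_nbhd (hN : IsNbhd N) (γ : Finset V) : γ ⊆ γ.biUnion N :=
  fun v hv => mem_biUnion.2 ⟨v, hv, hN.self_mem v⟩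

/-- Sort the sets that contain `e` by their component `γ` at `e`. The rest of the set avoids the
neighbourhood of `γ`, so the weight factorizes. -/
lemma xi_eq_add_sum (hN : IsNbhd N) (hw : IsMultiplicative N w) (e : V) (Λ : Finset V) :
    xi w Λ = xi w (Λ.erase e) + ∑ γ ∈ animals N e Λ, w γ * xi w (Λ \ γ.biUnion N) := by
  unfold xi
  rw [← sum_filter_add_sum_filter_not Λ.powerset (fun D => e ∉ D)]
  congr 1
  · refine sum_congr ?_ fun _ _ => rfl
    ext D
    simp only [mem_filter, mem_powerset, subset_erase]
  · rw [← sum_fiberwise_of_maps_to (t := animals N e Λ) (g := compAt N e)]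
    · refine sum_congr rfl fun γ hγ => ?_
      simp only [animals, mem_filter, mem_powerset] at hγ
      obtain ⟨hγΛ, heγ, hγ⟩ := hγ
      rw [mul_sum]
      refine sum_nbij' (fun D => D \ γ) (fun D => γ ∪ D) ?_ ?_ ?_ ?_ ?_
      · intro D hD
        simp only [mem_filter, mem_powerset, not_not] at hD
        simp only [mem_powerset]
        intro v hv
        rw [mem_sdiff] at hv ⊢
        refine ⟨hD.1.1 hv.1, fun h => hv.2 ?_⟩
        obtain ⟨a, ha, hva⟩ := mem_biUnion.1 h
        rw [← hD.2] at ha ⊢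
        exact mem_compAt_of_mem_nbhd ha hv.1 hva
      · intro D hD
        simp only [mem_powerset, subset_sdiff] at hD
        simp only [mem_filter, mem_powerset, not_not]
        exact ⟨⟨union_subset hγΛ hD.1, mem_union_left _ heγ⟩, compAt_union hγ heγ hD.2⟩
      · intro D hD
        simp only [mem_filter, mem_powerset, not_not] at hD
        exact union_sdiff_of_subset (hD.2 ▸ compAt_subset _ _)
      · intro D hD
        simp only [mem_powerset, subset_sdiff] at hD
        rw [union_sdiff_left, Finset.sdiff_eq_self_iff_disjoint]
        exact hD.2.mono_right (subset_biUnion_nbhd hN γ)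
      · intro D hD
        simp only [mem_filter, mem_powerset, not_not] at hD
        have hsub : γ ⊆ D := hD.2 ▸ compAt_subset _ _
        rw [← hw.union γ (D \ γ), union_sdiff_of_subset hsub]
        refine disjoint_left.2 fun v hv h => ?_
        rw [mem_sdiff] at hv
        refine hv.2 ?_
        obtain ⟨a, ha, hva⟩ := mem_biUnion.1 h
        rw [← hD.2] at ha ⊢
        exact mem_compAt_of_mem_nbhd ha hv.1 hva
    · intro D hD
      simp only [mem_filter, mem_powerset, not_not] at hD
      simp only [animals, mem_filter, mem_powerset]
      exact ⟨(compAt_subset _ _).trans hD.1, self_mem_compAt hD.2, compAt_compAt hD.2⟩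

lemma xi_mono (hw : ∀ D, 0 ≤ w D) {Λ Λ' : Finset V} (h : Λ ⊆ Λ') : xi w Λ ≤ xi w Λ' :=
  sum_le_sum_of_subset_of_nonneg (powerset_mono.2 h) fun D _ _ => hw D

lemma xi_empty (hw : IsMultiplicative N w) : xi w ∅ = 1 := by
  simp [xi, hw.empty]

lemma xi_pos (hw : IsMultiplicative N w) (Λ : Finset V) : 0 < xi w Λ :=
  zero_lt_one.trans_le ((xi_empty hw).symm.le.trans (xi_mono hw.nonneg (empty_subset Λ)))

lemma card_biUnion_nbhd_le (hM : ∀ e, #(N e) ≤ M) (γ : Finset V) : #(γ.biUnion N) ≤ M * #γ := by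
  rw [mul_comm]
  exact card_biUnion_le_card_mul _ _ _ fun e _ => hM e

/-- Counts animals by applying the recursion to the constant weight 1, whose partition function is a
power of 2. Deleting the neighbourhood of `γ` costs at most `M * #γ` factors 2. -/
lemma sum_animals_half_pow_le (hN : IsNbhd N) (hM : ∀ e, #(N e) ≤ M) (e : V) (Λ : Finset V) :
    ∑ γ ∈ animals N e Λ, ((1 / 2 : ℝ) ^ M) ^ #γ ≤ 1 := by
  have hw : IsMultiplicative N (fun _ => (1 : ℝ)) := ⟨rfl, fun _ => zero_le_one, by simp⟩
  have hxi : ∀ Λ : Finset V, xi (fun _ => (1 : ℝ)) Λ = 2 ^ #Λ := by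
    intro Λ
    simp [xi, card_powerset]
  have h := xi_eq_add_sum hN hw e Λ
  simp only [hxi, one_mul] at h
  have h1 : ∑ γ ∈ animals N e Λ, (2 : ℝ) ^ #(Λ \ γ.biUnion N) ≤ 2 ^ #Λ := by
    have : (0 : ℝ) ≤ 2 ^ #(Λ.erase e) := by positivity
    linarith
  have h2 : ∀ γ ∈ animals N e Λ,
      (2 : ℝ) ^ #Λ * ((1 / 2 : ℝ) ^ M) ^ #γ ≤ 2 ^ #(Λ \ γ.biUnion N) := by
    intro γ _
    have hc : #Λ ≤ #(Λ \ γ.biUnion N) + M * #γ := by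
      have := le_card_sdiff (γ.biUnion N) Λ
      have := card_biUnion_nbhd_le hM γ
      omega
    rw [← pow_mul, one_div, inv_pow, ← div_eq_mul_inv, div_le_iff₀ (by positivity), ← pow_add]
    exact pow_le_pow_right₀ one_le_two hc
  have h3 := (sum_le_sum h2).trans h1
  rw [← mul_sum] at h3
  have hp : (0 : ℝ) < 2 ^ #Λ := by positivity
  exact le_of_mul_le_mul_left (by linarith) hp

/-- Write z as (2^M z) 2^(-M); since an animal is nonempty, one factor 2^M z can be kept in front.
-/
lemma sum_animals_pow_le (hN : IsNbhd N) (hM : ∀ e, #(N e) ≤ M) {z : ℝ} (hz : 0 ≤ z)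
    (hz1 : 2 ^ M * z ≤ 1) (e : V) (Λ : Finset V) :
    ∑ γ ∈ animals N e Λ, z ^ #γ ≤ 2 ^ M * z := by
  have h : ∀ γ ∈ animals N e Λ, z ^ #γ ≤ 2 ^ M * z * ((1 / 2 : ℝ) ^ M) ^ #γ := by
    intro γ hγ
    simp only [animals, mem_filter] at hγ
    have hc : #γ ≠ 0 := (card_pos.2 ⟨e, hγ.2.1⟩).ne'
    have h1 : z = 2 ^ M * z * (1 / 2 : ℝ) ^ M := by
      rw [mul_right_comm, ← mul_pow]; norm_num
    calc z ^ #γ = (2 ^ M * z) ^ #γ * ((1 / 2 : ℝ) ^ M) ^ #γ := by rw [← mul_pow, ← h1]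
      _ ≤ _ := by
        gcongr
        exact pow_le_of_le_one (by positivity) hz1 hc
  refine (sum_le_sum h).trans ?_
  rw [← mul_sum]
  exact mul_le_of_le_one_right (by positivity) (sum_animals_half_pow_le hN hM e Λ)

lemma one_le_ratio (hw : IsMultiplicative N w) (e : V) (Λ : Finset V) : 1 ≤ ratio w e Λ := by
  rw [ratio, one_le_div (xi_pos hw _)]
  exact xi_mono hw.nonneg (erase_subset _ _)

/-- The recursion for the ratios of partition functions. -/
lemma ratio_eq (hN : IsNbhd N) (hw : IsMultiplicative N w) (e : V) (Λ : Finset V) :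
    ratio w e Λ =
      1 + ∑ γ ∈ animals N e Λ, w γ * (xi w (Λ \ γ.biUnion N) / xi w (Λ.erase e)) := by
  have h := (xi_pos hw (Λ.erase e)).ne'
  rw [ratio, div_eq_iff h, add_mul, one_mul, sum_mul, xi_eq_add_sum hN hw e Λ]
  congr 1
  refine sum_congr rfl fun γ _ => ?_
  field_simp

lemma sdiff_biUnion_subset_erase (hN : IsNbhd N) {e : V} {γ : Finset V} (he : e ∈ γ)
    (Λ : Finset V) : Λ \ γ.biUnion N ⊆ Λ.erase e := by
  intro v hv
  rw [mem_sdiff] at hv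
  refine mem_erase.2 ⟨?_, hv.1⟩
  rintro rfl
  exact hv.2 (subset_biUnion_nbhd hN γ he)

lemma ratio_le (hN : IsNbhd N) (hM : ∀ e, #(N e) ≤ M) (hw : IsMultiplicative N w) {y : ℝ}
    (hy : 0 ≤ y) (hy1 : 2 ^ M * y ≤ 1) (hwy : ∀ D, w D ≤ y ^ #D) (e : V) (Λ : Finset V) :
    ratio w e Λ ≤ 1 + 2 ^ M * y := by
  rw [ratio_eq hN hw]
  gcongr
  refine (sum_le_sum fun γ hγ => ?_).trans (sum_animals_pow_le hN hM hy hy1 e Λ)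
  simp only [animals, mem_filter] at hγ
  refine (mul_le_of_le_one_right (hw.nonneg γ) ?_).trans (hwy γ)
  rw [div_le_one (xi_pos hw _)]
  exact xi_mono hw.nonneg (sdiff_biUnion_subset_erase hN hγ.2.1 Λ)

/-- Removing `S` point by point turns each quotient into a product of inverse ratios. All factors
lie in [0, 1], so the errors add up. -/
lemma abs_xi_sdiff_div_sub_le (hw : IsMultiplicative N w) {b : ℝ} {Λ Λ' : Finset V}
    (S : Finset V)
    (h : ∀ a ∈ S, ∀ T ⊆ S, |ratio w a (Λ \ T) - ratio w a (Λ' \ T)| ≤ b) :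
    |xi w (Λ \ S) / xi w Λ - xi w (Λ' \ S) / xi w Λ'| ≤ #S * b := by
  induction S using Finset.induction_on with
  | empty => simp [div_self (xi_pos hw _).ne']
  | insert a s ha ih =>
    have ih' := ih fun c hc T hT => h c (mem_insert_of_mem hc) T (hT.trans (subset_insert _ _))
    have hab := h a (mem_insert_self _ _) s (subset_insert _ _)
    have key : ∀ Λ : Finset V, xi w (Λ \ insert a s) / xi w Λ =
        xi w (Λ \ s) / xi w Λ * (ratio w a (Λ \ s))⁻¹ := by
      intro Λ
      have h1 := (xi_pos hw (Λ \ s)).ne'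
      have h2 : Λ \ insert a s = (Λ \ s).erase a := by
        ext v
        simp only [mem_sdiff, mem_insert, mem_erase]
        tauto
      rw [h2, ratio, inv_div]
      field_simp
    rw [key, key, card_insert_of_notMem ha]
    push_cast
    have hu : ∀ Λ : Finset V, 0 ≤ xi w (Λ \ s) / xi w Λ ∧ xi w (Λ \ s) / xi w Λ ≤ 1 := fun Λ =>
      ⟨div_nonneg (xi_pos hw _).le (xi_pos hw _).le,
        (div_le_one (xi_pos hw _)).2 (xi_mono hw.nonneg sdiff_subset)⟩
    have hR := one_le_ratio hw a (Λ \ s)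
    have hR' := one_le_ratio hw a (Λ' \ s)
    have hinv : |(ratio w a (Λ \ s))⁻¹ - (ratio w a (Λ' \ s))⁻¹| ≤ b := by
      rw [inv_sub_inv (by positivity) (by positivity), abs_div, abs_sub_comm]
      refine (div_le_self (abs_nonneg _) ?_).trans hab
      rw [abs_of_pos (by positivity)]
      nlinarith
    have hv : (ratio w a (Λ \ s))⁻¹ ≤ 1 := inv_le_one_of_one_le₀ hR
    have hv0 : 0 ≤ (ratio w a (Λ \ s))⁻¹ := by positivity
    generalize (ratio w a (Λ \ s))⁻¹ = v at *
    generalize (ratio w a (Λ' \ s))⁻¹ = v' at *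
    obtain ⟨hu0, hu1⟩ := hu Λ'
    generalize xi w (Λ \ s) / xi w Λ = u at *
    generalize xi w (Λ' \ s) / xi w Λ' = u' at *
    calc |u * v - u' * v'| = |(u - u') * v + u' * (v - v')| := by ring_nf
      _ ≤ |(u - u') * v| + |u' * (v - v')| := abs_add_le _ _
      _ ≤ |u - u'| + |v - v'| := by
        rw [abs_mul, abs_mul, abs_of_nonneg hv0, abs_of_nonneg hu0]
        exact add_le_add (mul_le_of_le_one_right (abs_nonneg _) hv)
          (mul_le_of_le_one_left (abs_nonneg _) hu1)
      _ ≤ (#s + 1) * b := by linarith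

end Polymer

set_option linter.unusedSectionVars false

/-! ### Exponential decay of the dependence on the domain, and infinite domains. -/

namespace Polymer

open Finset Relation Filter
open scoped Classical

variable {V X : Type*} [DecidableEq V] [PseudoMetricSpace X] {N : V → Finset V} {w : Finset V → ℝ} {M : ℕ}
  {c : V → X}

/-- A path inside `γ` visits distinct points, so it has fewer than `#γ` steps, each of length at
most 1. -/
lemma dist_lt_card_of_compAt_eq (hc : ∀ a b, b ∈ N a → dist (c a) (c b) ≤ 1) {e v : V}
    {γ : Finset V} (he : e ∈ γ) (hγ : compAt N e γ = γ) (hv : v ∈ γ) :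
    dist (c e) (c v) + 1 ≤ #γ := by
  let G : SimpleGraph γ := SimpleGraph.fromRel fun a b => (b : V) ∈ N a
  have hstep : ∀ a b : γ, G.Adj a b → dist (c a) (c b) ≤ 1 := by
    intro a b hab
    rcases ((SimpleGraph.fromRel_adj _ _ _).1 hab).2 with h | h
    · exact hc _ _ h
    · rw [dist_comm]; exact hc _ _ h
  have hwalk : ∀ {a b : γ} (p : G.Walk a b), dist (c a) (c b) ≤ p.length := by
    intro a b p
    induction p with
    | nil => simp
    | cons h p ih =>
      rw [SimpleGraph.Walk.length_cons]
      push_cast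
      linarith [dist_triangle (c _) (c _) (c _) |>.trans (add_le_add (hstep _ _ h) ih)]
  have hreach : ∃ hv : v ∈ γ, G.Reachable ⟨e, he⟩ ⟨v, hv⟩ := by
    rw [← hγ] at hv
    have hr := (mem_filter.1 hv).2
    clear hv
    induction hr with
    | refl => exact ⟨he, .rfl⟩
    | @tail a b _ hab ih =>
      obtain ⟨ha, ih⟩ := ih
      refine ⟨hab.2, ?_⟩
      by_cases h : a = b
      · subst h; exact ih
      · refine ih.trans (SimpleGraph.Adj.reachable ?_)
        exact (SimpleGraph.fromRel_adj _ _ _).2 ⟨by simpa using h, Or.inl hab.1⟩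
  obtain ⟨hv, hr⟩ := hreach
  obtain ⟨p, hp⟩ := hr.exists_isPath
  have h1 := hwalk p
  have h2 := hp.length_lt
  rw [Fintype.card_coe] at h2
  have h3 : (p.length : ℝ) + 1 ≤ #γ := by exact_mod_cast h2
  linarith

lemma dist_le_card_of_mem_biUnion (hc : ∀ a b, b ∈ N a → dist (c a) (c b) ≤ 1) {e v : V}
    {γ : Finset V} (he : e ∈ γ) (hγ : compAt N e γ = γ) (hv : v ∈ γ.biUnion N) :
    dist (c e) (c v) ≤ #γ := by
  obtain ⟨a, ha, hva⟩ := mem_biUnion.1 hv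
  have := dist_lt_card_of_compAt_eq hc he hγ ha
  linarith [hc a v hva, dist_triangle (c e) (c a) (c v)]

/-- A common index set allows the recursions on two domains to be subtracted term by term. -/
lemma ratio_eq_of_subset (hN : IsNbhd N) (hw : IsMultiplicative N w) (e : V) {Λ Λ₀ : Finset V}
    (h : Λ ⊆ Λ₀) :
    ratio w e Λ = 1 + ∑ γ ∈ animals N e Λ₀,
      w γ * if γ ⊆ Λ then xi w (Λ \ γ.biUnion N) / xi w (Λ.erase e) else 0 := by
  rw [ratio_eq hN hw]
  congr 1
  simp only [mul_ite, mul_zero]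
  rw [← sum_filter]
  refine sum_congr ?_ fun _ _ => rfl
  ext γ
  simp only [animals, mem_filter, mem_powerset]
  constructor
  · rintro ⟨h1, h2⟩; exact ⟨⟨h1.trans h, h2⟩, h1⟩
  · rintro ⟨⟨_, h2⟩, h1⟩; exact ⟨h1, h2⟩

lemma sdiff_biUnion_eq_erase_sdiff (hN : IsNbhd N) {e : V} {γ : Finset V} (he : e ∈ γ)
    (Λ : Finset V) : Λ \ γ.biUnion N = Λ.erase e \ γ.biUnion N := by
  ext v
  simp only [Finset.mem_sdiff, mem_erase]
  constructor
  · rintro ⟨h1, h2⟩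
    refine ⟨⟨?_, h1⟩, h2⟩
    rintro rfl
    exact h2 (subset_biUnion_nbhd hN γ he)
  · rintro ⟨⟨_, h1⟩, h2⟩; exact ⟨h1, h2⟩

/-- The ratio of partition functions depends weakly on the domain far away. -/
theorem abs_ratio_sub_le (hN : IsNbhd N) (hM : ∀ e, #(N e) ≤ M)
    (hc : ∀ a b, b ∈ N a → dist (c a) (c b) ≤ 1) (hw : IsMultiplicative N w) {y θ : ℝ}
    (hy : 0 ≤ y) (hwy : ∀ D, w D ≤ y ^ #D) (hθ : 0 < θ) (hθ1 : θ ≤ 1)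
    (hyθ : 2 ^ M * (2 * M * y) ≤ θ) (n : ℕ) :
    ∀ (e : V) (Λ Λ' : Finset V), (∀ v, dist (c e) (c v) ≤ n → (v ∈ Λ ↔ v ∈ Λ')) →
      |ratio w e Λ - ratio w e Λ'| ≤ θ ^ n := by
  induction n using Nat.strong_induction_on with
  | _ n ih =>
  intro e Λ Λ' hΛ
  have hMpos : 1 ≤ M := (card_pos.2 ⟨e, hN.self_mem e⟩).trans_le (hM e)
  have hP : ∀ (γ Λ : Finset V), e ∈ γ →
      0 ≤ xi w (Λ \ γ.biUnion N) / xi w (Λ.erase e) ∧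
        xi w (Λ \ γ.biUnion N) / xi w (Λ.erase e) ≤ 1 := fun γ Λ he =>
    ⟨div_nonneg (xi_pos hw _).le (xi_pos hw _).le,
      (div_le_one (xi_pos hw _)).2 (xi_mono hw.nonneg (sdiff_biUnion_subset_erase hN he Λ))⟩
  -- The factor θ^#γ avoids a negative power: the induction hypothesis is available only up to
  -- distance n - #γ.
  have key : ∀ γ ∈ animals N e (Λ ∪ Λ'),
      |(if γ ⊆ Λ then xi w (Λ \ γ.biUnion N) / xi w (Λ.erase e) else 0) -
        (if γ ⊆ Λ' then xi w (Λ' \ γ.biUnion N) / xi w (Λ'.erase e) else 0)| * θ ^ #γ ≤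
        (2 * M : ℝ) ^ #γ * θ ^ n := by
    intro γ hγ
    simp only [animals, mem_filter, mem_powerset] at hγ
    obtain ⟨-, heγ, hγ⟩ := hγ
    have hcard : 0 < #γ := card_pos.2 ⟨e, heγ⟩
    have hpow : (M * #γ : ℝ) ≤ (2 * M : ℝ) ^ #γ := by
      rw [mul_pow, mul_comm]
      have h1 : (#γ : ℝ) ≤ 2 ^ #γ := by exact_mod_cast (Nat.lt_two_pow_self (n := #γ)).le
      have h2 : (M : ℝ) ≤ M ^ #γ := by exact_mod_cast Nat.le_self_pow hcard.ne' M
      gcongr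
    -- An animal larger than n may see the difference of the domains, but then θ^#γ already supplies
    -- θ^n.
    by_cases hn : n < #γ
    · have h1 : |(if γ ⊆ Λ then xi w (Λ \ γ.biUnion N) / xi w (Λ.erase e) else 0) -
        (if γ ⊆ Λ' then xi w (Λ' \ γ.biUnion N) / xi w (Λ'.erase e) else 0)| ≤ 1 := by
        have ha := hP γ Λ heγ
        have hb := hP γ Λ' heγ
        rw [abs_le]
        split_ifs <;> constructor <;> linarith
      have h2 : (1 : ℝ) ≤ (2 * M : ℝ) ^ #γ := by
        refine le_trans ?_ hpow
        exact_mod_cast Nat.mul_pos hMpos hcard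
      calc _ ≤ 1 * θ ^ #γ := by gcongr
        _ ≤ 1 * θ ^ n := by
          gcongr 1 * ?_
          exact pow_le_pow_of_le_one hθ.le hθ1 hn.le
        _ ≤ _ := by gcongr
    · rw [not_lt] at hn
      have hball : ∀ v ∈ γ.biUnion N, dist (c e) (c v) ≤ #γ := fun v hv =>
        dist_le_card_of_mem_biUnion hc heγ hγ hv
      have hsub : γ ⊆ Λ ↔ γ ⊆ Λ' := by
        have hmem : ∀ v ∈ γ, (v ∈ Λ ↔ v ∈ Λ') := fun v hv =>
          hΛ v ((hball v (subset_biUnion_nbhd hN γ hv)).trans (by exact_mod_cast hn))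
        exact ⟨fun h v hv => (hmem v hv).1 (h hv), fun h v hv => (hmem v hv).2 (h hv)⟩
      have hdiff : |xi w (Λ \ γ.biUnion N) / xi w (Λ.erase e) -
          xi w (Λ' \ γ.biUnion N) / xi w (Λ'.erase e)| ≤ #(γ.biUnion N) * θ ^ (n - #γ) := by
        -- Numerator and denominator now differ by removing points within distance #γ of `e`, so
        -- telescoping and the induction hypothesis apply.
        rw [sdiff_biUnion_eq_erase_sdiff hN heγ Λ, sdiff_biUnion_eq_erase_sdiff hN heγ Λ']
        refine abs_xi_sdiff_div_sub_le hw _ fun a ha T _ => ih _ (by omega) a _ _ fun v hv => ?_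
        have hv' : dist (c e) (c v) ≤ n := by
          have := hball a ha
          rw [Nat.cast_sub hn] at hv
          linarith [dist_triangle (c e) (c a) (c v)]
        simp only [Finset.mem_sdiff, mem_erase, hΛ v hv']
      have hle : (#(γ.biUnion N) : ℝ) ≤ M * #γ := by exact_mod_cast card_biUnion_nbhd_le hM γ
      have hθn : θ ^ (n - #γ) * θ ^ #γ = θ ^ n := by rw [← pow_add, Nat.sub_add_cancel hn]
      have hmain : |(if γ ⊆ Λ then xi w (Λ \ γ.biUnion N) / xi w (Λ.erase e) else 0) -
          (if γ ⊆ Λ' then xi w (Λ' \ γ.biUnion N) / xi w (Λ'.erase e) else 0)| ≤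
          (2 * M : ℝ) ^ #γ * θ ^ (n - #γ) := by
        by_cases h : γ ⊆ Λ
        · rw [if_pos h, if_pos (hsub.1 h)]
          exact hdiff.trans (by gcongr; exact hle.trans hpow)
        · rw [if_neg h, if_neg (mt hsub.2 h), sub_zero, abs_zero]
          positivity
      calc _ ≤ (2 * M : ℝ) ^ #γ * θ ^ (n - #γ) * θ ^ #γ := by gcongr
        _ = _ := by rw [mul_assoc, hθn]
  rw [ratio_eq_of_subset hN hw e (subset_union_left (s₁ := Λ) (s₂ := Λ')),
    ratio_eq_of_subset hN hw e (subset_union_right (s₁ := Λ) (s₂ := Λ')), add_sub_add_left_eq_sub,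
    ← sum_sub_distrib]
  -- The loss (2M/θ)^#γ is absorbed into the activity, which `hyθ` keeps summable.
  have hz : (0 : ℝ) ≤ 2 * M * y / θ := by positivity
  have hz1 : 2 ^ M * (2 * M * y / θ) ≤ 1 := by
    rw [← mul_div_assoc, div_le_one hθ]; exact hyθ
  refine (abs_sum_le_sum_abs _ _).trans ?_
  calc _ ≤ ∑ γ ∈ animals N e (Λ ∪ Λ'), (2 * M * y / θ) ^ #γ * θ ^ n := by
        refine sum_le_sum fun γ hγ => ?_
        rw [← mul_sub, abs_mul, abs_of_nonneg (hw.nonneg γ), div_pow, mul_pow, div_mul_eq_mul_div,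
          le_div_iff₀ (by positivity), mul_assoc]
        calc _ ≤ y ^ #γ * ((2 * M : ℝ) ^ #γ * θ ^ n) :=
              mul_le_mul (hwy γ) (key γ hγ) (by positivity) (by positivity)
          _ = _ := by ring
    _ = (∑ γ ∈ animals N e (Λ ∪ Λ'), (2 * M * y / θ) ^ #γ) * θ ^ n := by rw [sum_mul]
    _ ≤ 1 * θ ^ n := by
      gcongr
      exact (sum_animals_pow_le hN hM hz hz1 e _).trans hz1
    _ = θ ^ n := one_mul _

/-- The common bound `B` is needed because a real `limsup` is meaningful only for bounded functions.
-/
lemma abs_limsup_sub_limsup_le {ι : Type*} {l : Filter ι} [l.NeBot] {a b : ι → ℝ} {ε B : ℝ}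
    (ha : ∀ i, |a i| ≤ B) (hb : ∀ i, |b i| ≤ B) (h : ∀ i, |a i - b i| ≤ ε) :
    |limsup a l - limsup b l| ≤ ε := by
  have bdd : ∀ {a : ι → ℝ} {B : ℝ}, (∀ i, |a i| ≤ B) → IsBoundedUnder (· ≤ ·) l a ∧
      IsCoboundedUnder (· ≤ ·) l a := by
    intro a B ha
    have h1 : IsBoundedUnder (· ≤ ·) l a := isBoundedUnder_of ⟨B, fun i => (abs_le.1 (ha i)).2⟩
    have h2 : IsBoundedUnder (· ≥ ·) l a := isBoundedUnder_of ⟨-B, fun i => (abs_le.1 (ha i)).1⟩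
    exact ⟨h1, h2.isCoboundedUnder_le⟩
  have key : ∀ {a b : ι → ℝ}, (∀ i, |a i| ≤ B) → (∀ i, |b i| ≤ B) → (∀ i, |a i - b i| ≤ ε) →
      limsup a l ≤ limsup b l + ε := by
    intro a b ha hb h
    rw [← limsup_add_const l b ε (bdd hb).1 (bdd hb).2]
    refine limsup_le_limsup (Eventually.of_forall fun i => ?_) (bdd ha).2
      (bdd (a := fun i => b i + ε) (B := B + |ε|) fun i =>
        (abs_add_le _ _).trans (by gcongr; exact hb i)).1
    linarith [(abs_le.1 (h i)).2]
  rw [abs_le]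
  have h1 := key ha hb h
  have h2 := key hb ha fun i => by rw [abs_sub_comm]; exact h i
  constructor <;> linarith

/-- The logarithm of the ratio of partition functions, extended to infinite domains. -/
def logRatio (w : Finset V → ℝ) (e : V) (Λ : Set V) : ℝ :=
  limsup (fun S : Finset V => Real.log (ratio w e (S.filter (· ∈ Λ)))) atTop

/-- The sequence is constant once `S` contains `Λ`. On infinite domains convergence is never needed,
since uniform bounds pass to the `limsup`. -/
lemma logRatio_coe (e : V) (Λ : Finset V) :
    logRatio w e (Λ : Set V) = Real.log (ratio w e Λ) := by
  rw [logRatio, limsup_congr (v := fun _ => Real.log (ratio w e Λ)), limsup_const]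
  filter_upwards [eventually_ge_atTop Λ] with S hS
  congr 2
  ext v
  simpa using fun h => hS h

lemma abs_log_sub_log_le {x y : ℝ} (hx : 1 ≤ x) (hy : 1 ≤ y) :
    |Real.log x - Real.log y| ≤ |x - y| := by
  have key : ∀ {x y : ℝ}, 1 ≤ x → 1 ≤ y → y ≤ x → |Real.log x - Real.log y| ≤ |x - y| := by
    intro x y hx hy hxy
    have h0 : Real.log y ≤ Real.log x := Real.log_le_log (by linarith) hxy
    rw [abs_of_nonneg (by linarith), abs_of_nonneg (by linarith),
      ← Real.log_div (by linarith) (by linarith)]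
    refine (Real.log_le_sub_one_of_pos (by positivity)).trans ?_
    rw [div_sub_one (by linarith)]
    exact div_le_self (by linarith) hy
  rcases le_total y x with h | h
  · exact key hx hy h
  · rw [abs_sub_comm, abs_sub_comm x]
    exact key hy hx h

lemma abs_log_ratio_le (hN : IsNbhd N) (hM : ∀ e, #(N e) ≤ M) (hw : IsMultiplicative N w) {y : ℝ}
    (hy : 0 ≤ y) (hy1 : 2 ^ M * y ≤ 1) (hwy : ∀ D, w D ≤ y ^ #D) (e : V) (Λ : Finset V) :
    |Real.log (ratio w e Λ)| ≤ 2 ^ M * y := by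
  have h1 := one_le_ratio hw e Λ
  have h2 := ratio_le hN hM hw hy hy1 hwy e Λ
  have h3 := abs_log_sub_log_le h1 le_rfl
  rw [Real.log_one, sub_zero, abs_of_nonneg (a := ratio w e Λ - 1) (by linarith)] at h3
  linarith

lemma abs_logRatio_le (hN : IsNbhd N) (hM : ∀ e, #(N e) ≤ M) (hw : IsMultiplicative N w) {y : ℝ}
    (hy : 0 ≤ y) (hy1 : 2 ^ M * y ≤ 1) (hwy : ∀ D, w D ≤ y ^ #D) (e : V) (Λ : Set V) :
    |logRatio w e Λ| ≤ 2 ^ M * y := by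
  have hb : ∀ S : Finset V, |Real.log (ratio w e (S.filter (· ∈ Λ)))| ≤ 2 ^ M * y := fun S =>
    abs_log_ratio_le hN hM hw hy hy1 hwy e _
  have h := abs_limsup_sub_limsup_le (l := atTop) (b := fun _ => 0) hb
    (fun _ => by rw [abs_zero]; positivity) (fun S => by rw [sub_zero]; exact hb S)
  rwa [limsup_const, sub_zero] at h

lemma abs_logRatio_sub_le (hN : IsNbhd N) (hM : ∀ e, #(N e) ≤ M)
    (hc : ∀ a b, b ∈ N a → dist (c a) (c b) ≤ 1) (hw : IsMultiplicative N w) {y θ : ℝ}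
    (hy : 0 ≤ y) (hy1 : 2 ^ M * y ≤ 1) (hwy : ∀ D, w D ≤ y ^ #D) (hθ : 0 < θ) (hθ1 : θ ≤ 1)
    (hyθ : 2 ^ M * (2 * M * y) ≤ θ) (n : ℕ) (e : V) (Λ Λ' : Set V)
    (hΛ : ∀ v, dist (c e) (c v) ≤ n → (v ∈ Λ ↔ v ∈ Λ')) :
    |logRatio w e Λ - logRatio w e Λ'| ≤ θ ^ n := by
  refine abs_limsup_sub_limsup_le (B := 2 ^ M * y) (fun S => abs_log_ratio_le hN hM hw hy hy1 hwy e _)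
    (fun S => abs_log_ratio_le hN hM hw hy hy1 hwy e _) fun S => ?_
  refine (abs_log_sub_log_le (one_le_ratio hw _ _) (one_le_ratio hw _ _)).trans ?_
  refine abs_ratio_sub_le hN hM hc hw hy hwy hθ hθ1 hyθ n e _ _ fun v hv => ?_
  simp only [mem_filter, hΛ v hv]

lemma xi_map (τ : V ≃ V) (hτ : ∀ D : Finset V, w (D.map τ.toEmbedding) = w D) (Λ : Finset V) :
    xi w (Λ.map τ.toEmbedding) = xi w Λ := by
  refine (sum_nbij' (fun D => D.map τ.toEmbedding) (fun D => D.map τ.symm.toEmbedding)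
    ?_ ?_ ?_ ?_ fun D _ => (hτ D).symm).symm
  · intro D hD
    rw [mem_powerset] at hD ⊢
    exact map_subset_map.2 hD
  · intro D hD
    rw [mem_powerset] at hD ⊢
    intro v hv
    have := hD ((mem_map_equiv (f := τ.symm)).1 hv)
    simpa using this
  · intro D _
    ext v
    simp
  · intro D _
    ext v
    simp

lemma ratio_map (τ : V ≃ V) (hτ : ∀ D : Finset V, w (D.map τ.toEmbedding) = w D) (e : V)
    (Λ : Finset V) : ratio w (τ e) (Λ.map τ.toEmbedding) = ratio w e Λ := by
  have h : (Λ.map τ.toEmbedding).erase (τ e) = (Λ.erase e).map τ.toEmbedding := by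
    ext v
    simp
  rw [ratio, ratio, h, xi_map τ hτ, xi_map τ hτ]

/-- `τ` induces an order isomorphism of the finite sets, which preserves `atTop`. -/
lemma logRatio_image (τ : V ≃ V) (hτ : ∀ D : Finset V, w (D.map τ.toEmbedding) = w D) (e : V)
    (Λ : Set V) : logRatio w (τ e) (τ '' Λ) = logRatio w e Λ := by
  let φ : Finset V ≃o Finset V := ⟨τ.finsetCongr, map_subset_map⟩
  rw [logRatio, ← φ.map_atTop, logRatio, ← limsup_comp]
  congr 1
  ext S
  have h : (φ S).filter (· ∈ τ '' Λ) = (S.filter (· ∈ Λ)).map τ.toEmbedding := by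
    change (S.map τ.toEmbedding).filter (· ∈ τ '' Λ) = _
    ext v
    simp only [mem_filter, mem_map_equiv, Set.mem_image_equiv]
  rw [Function.comp_apply, h, ratio_map τ hτ]

end Polymer

/-! ### Mod 2 cochains on the cubic lattice and counting of components. -/

namespace RandomCluster

open scoped Classical

lemma cubicLattice_adj_iff {x y : Site} : cubicLattice.Adj x y ↔
    ∃ i, y = x + Pi.single i 1 ∨ x = y + Pi.single i 1 := by
  change ∑ i, |x i - y i| = 1 ↔ _
  constructor
  · intro h
    rw [Fin.sum_univ_three] at h
    have h3 : ∀ a : ℤ, |a| = 0 ∨ 1 ≤ |a| := fun a => by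
      have := abs_nonneg a; omega
    have key : ∀ i : Fin 3, |x i - y i| = 1 → (∀ j, j ≠ i → |x j - y j| = 0) →
        ∃ i, y = x + Pi.single i 1 ∨ x = y + Pi.single i 1 := by
      intro i hi hj
      refine ⟨i, ?_⟩
      have hj' : ∀ j, j ≠ i → x j = y j := fun j hji => by
        have := abs_eq_zero.1 (hj j hji); omega
      rcases (abs_eq zero_le_one).1 hi with h | h
      · right
        ext j
        by_cases hji : j = i
        · subst hji; simp; omega
        · simp [hji, hj' j hji]
      · left
        ext j
        by_cases hji : j = i
        · subst hji; simp; omega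
        · simp [hji, hj' j hji]
    have n0 := abs_nonneg (x 0 - y 0)
    have n1 := abs_nonneg (x 1 - y 1)
    have n2 := abs_nonneg (x 2 - y 2)
    rcases h3 (x 0 - y 0) with h0 | h0
    · rcases h3 (x 1 - y 1) with h1 | h1
      · exact key 2 (by omega) (by
          intro j hj
          fin_cases j <;> first
            | exact absurd rfl hj
            | (change |x 0 - y 0| = 0; omega)
            | (change |x 1 - y 1| = 0; omega))
      · exact key 1 (by omega) (by
          intro j hj
          fin_cases j <;> first
            | exact absurd rfl hj
            | (change |x 0 - y 0| = 0; omega)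
            | (change |x 2 - y 2| = 0; omega))
    · exact key 0 (by omega) (by
        intro j hj
        fin_cases j <;> first
          | exact absurd rfl hj
          | (change |x 1 - y 1| = 0; omega)
          | (change |x 2 - y 2| = 0; omega))
  · rintro ⟨i, rfl | rfl⟩ <;> fin_cases i <;> simp [Fin.sum_univ_three, Pi.single_apply]

lemma adj_add_single (x : Site) (i : Fin 3) : cubicLattice.Adj x (x + Pi.single i 1) :=
  cubicLattice_adj_iff.2 ⟨i, .inl rfl⟩

lemma squareSides_subset (x : Site) (i j : Fin 3) :
    squareSides x i j ⊆ cubicLattice.edgeSet := by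
  rintro e (rfl | rfl | rfl | rfl)
  · exact adj_add_single _ _
  · exact adj_add_single _ _
  · exact adj_add_single _ _
  · rw [add_right_comm]
    exact adj_add_single _ _

/-- Discrete primitives of `ZMod 2`-valued functions on `ℤ`. -/
def primitive (a : ℤ → ZMod 2) (n : ℤ) : ZMod 2 :=
  -- At most one of the intervals is nonempty; the sign of the second sum is immaterial mod 2.
  ∑ t ∈ Finset.Ico 0 n, a t + ∑ t ∈ Finset.Ico n 0, a t

lemma primitive_zero (a : ℤ → ZMod 2) : primitive a 0 = 0 := by simp [primitive]

lemma primitive_add_one (a : ℤ → ZMod 2) (n : ℤ) :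
    primitive a (n + 1) = primitive a n + a n := by
  rcases le_or_gt 0 n with h | h
  · have h1 : Finset.Ico 0 (n + 1) = insert n (Finset.Ico 0 n) := by
      ext t; simp only [Finset.mem_Ico, Finset.mem_insert]; omega
    have h2 : Finset.Ico (n + 1) 0 = ∅ := Finset.Ico_eq_empty_of_le (by omega)
    have h3 : Finset.Ico n 0 = ∅ := Finset.Ico_eq_empty_of_le (by omega)
    rw [primitive, primitive, h1, h2, h3, Finset.sum_insert (by simp)]
    simp [add_comm]
  · have h1 : Finset.Ico n 0 = insert n (Finset.Ico (n + 1) 0) := by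
      ext t; simp only [Finset.mem_Ico, Finset.mem_insert]; omega
    have h2 : Finset.Ico 0 (n + 1) = ∅ := Finset.Ico_eq_empty_of_le (by omega)
    have h3 : Finset.Ico 0 n = ∅ := Finset.Ico_eq_empty_of_le (by omega)
    rw [primitive, primitive, h1, h2, h3, Finset.sum_insert (by simp)]
    simp only [Finset.sum_empty, zero_add]
    rw [add_right_comm, CharTwo.add_self_eq_zero, zero_add]

/-- The fundamental theorem of calculus for `u`, whose increments are a + b. -/
lemma primitive_add_primitive {a b u : ℤ → ZMod 2} (h : ∀ n, u (n + 1) = u n + (a n + b n))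
    (n : ℤ) : primitive a n + primitive b n = u n + u 0 := by
  have step : ∀ n, primitive a (n + 1) + primitive b (n + 1) + u (n + 1) =
      primitive a n + primitive b n + u n := by
    intro n
    rw [primitive_add_one, primitive_add_one, h]
    linear_combination CharTwo.add_self_eq_zero (a n) + CharTwo.add_self_eq_zero (b n)
  have key : primitive a n + primitive b n + u n = u 0 := by
    induction n using Int.induction_on with
    | zero => simp [primitive_zero]
    | succ n ih => rw [step, ih]
    | pred n ih => rw [← step, sub_add_cancel, ih]
  linear_combination key - CharTwo.add_self_eq_zero (u n)

/-- A `ZMod 2`-valued cochain on the edges of `ℤ³` that is closed on unit squares is exact. -/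
lemma exists_potential (c : Sym2 Site → ZMod 2)
    (hc : ∀ (x : Site) (i j : Fin 3), i ≠ j →
      c s(x, x + Pi.single i 1) + c s(x, x + Pi.single j 1) +
        c s(x + Pi.single i 1, x + Pi.single i 1 + Pi.single j 1) +
        c s(x + Pi.single j 1, x + Pi.single i 1 + Pi.single j 1) = 0) :
    ∃ f : Site → ZMod 2, ∀ x i, f (x + Pi.single i 1) = f x + c s(x, x + Pi.single i 1) := by
  let a : Fin 3 → ℤ → ℤ → ℤ → ZMod 2 := fun i x y z =>
    c s(![x, y, z], ![x, y, z] + Pi.single i 1)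
  have e0 : ∀ x y z : ℤ, (![x, y, z] : Site) + Pi.single 0 1 = ![x + 1, y, z] := by
    intro x y z; ext j; fin_cases j <;> simp
  have e1 : ∀ x y z : ℤ, (![x, y, z] : Site) + Pi.single 1 1 = ![x, y + 1, z] := by
    intro x y z; ext j; fin_cases j <;> simp
  have e2 : ∀ x y z : ℤ, (![x, y, z] : Site) + Pi.single 2 1 = ![x, y, z + 1] := by
    intro x y z; ext j; fin_cases j <;> simp
  have h01 : ∀ x y z, a 0 x (y + 1) z = a 0 x y z + (a 1 (x + 1) y z + a 1 x y z) := by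
    intro x y z
    have := hc ![x, y, z] 0 1 (by decide)
    simp only [a, e0, e1] at this ⊢
    linear_combination this - CharTwo.add_self_eq_zero (c s(![x, y, z], ![x + 1, y, z])) -
      CharTwo.add_self_eq_zero (c s(![x, y, z], ![x, y + 1, z])) -
      CharTwo.add_self_eq_zero (c s(![x + 1, y, z], ![x + 1, y + 1, z]))
  have h02 : ∀ x y z, a 0 x y (z + 1) = a 0 x y z + (a 2 (x + 1) y z + a 2 x y z) := by
    intro x y z
    have := hc ![x, y, z] 0 2 (by decide)
    simp only [a, e0, e2] at this ⊢
    linear_combination this - CharTwo.add_self_eq_zero (c s(![x, y, z], ![x + 1, y, z])) -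
      CharTwo.add_self_eq_zero (c s(![x, y, z], ![x, y, z + 1])) -
      CharTwo.add_self_eq_zero (c s(![x + 1, y, z], ![x + 1, y, z + 1]))
  have h12 : ∀ x y z, a 1 x y (z + 1) = a 1 x y z + (a 2 x (y + 1) z + a 2 x y z) := by
    intro x y z
    have := hc ![x, y, z] 1 2 (by decide)
    simp only [a, e1, e2] at this ⊢
    linear_combination this - CharTwo.add_self_eq_zero (c s(![x, y, z], ![x, y + 1, z])) -
      CharTwo.add_self_eq_zero (c s(![x, y, z], ![x, y, z + 1])) -
      CharTwo.add_self_eq_zero (c s(![x, y + 1, z], ![x, y + 1, z + 1]))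
  -- Integrate the cochain from the origin along the three axes in turn.
  let F : ℤ → ℤ → ℤ → ZMod 2 := fun x y z => primitive (fun t => a 0 t 0 0) x +
    primitive (fun t => a 1 x t 0) y + primitive (fun t => a 2 x y t) z
  -- Closedness on squares turns the change of the later integrals into boundary values of `a 0`,
  -- which cancel all but the last one.
  have hF0 : ∀ x y z, F (x + 1) y z = F x y z + a 0 x y z := by
    intro x y z
    have h1 := primitive_add_primitive (u := fun n => a 0 x n 0) (fun n => h01 x n 0) y
    have h2 := primitive_add_primitive (u := a 0 x y) (fun n => h02 x y n) z
    simp only [F, primitive_add_one]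
    linear_combination h1 + h2 - CharTwo.add_self_eq_zero (primitive (fun t => a 1 x t 0) y) -
      CharTwo.add_self_eq_zero (primitive (fun t => a 2 x y t) z) +
      CharTwo.add_self_eq_zero (a 0 x y 0) + CharTwo.add_self_eq_zero (a 0 x 0 0)
  have hF1 : ∀ x y z, F x (y + 1) z = F x y z + a 1 x y z := by
    intro x y z
    have h2 := primitive_add_primitive (u := a 1 x y) (fun n => h12 x y n) z
    simp only [F, primitive_add_one]
    linear_combination h2 - CharTwo.add_self_eq_zero (primitive (fun t => a 2 x y t) z) +
      CharTwo.add_self_eq_zero (a 1 x y 0)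
  have hF2 : ∀ x y z, F x y (z + 1) = F x y z + a 2 x y z := by
    intro x y z
    simp only [F, primitive_add_one]
    ring
  refine ⟨fun v => F (v 0) (v 1) (v 2), fun v i => ?_⟩
  have hv : v = ![v 0, v 1, v 2] := by ext j; fin_cases j <;> rfl
  generalize v 0 = x at hv
  generalize v 1 = y at hv
  generalize v 2 = z at hv
  subst hv
  fin_cases i
  · have := hF0 x y z
    simpa [a] using this
  · have := hF1 x y z
    simpa [a] using this
  · have := hF2 x y z
    simpa [a] using this

/-- The lattice with the edges in `S` removed. -/
def cut (S : Set (Sym2 Site)) : SimpleGraph Site :=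
  SimpleGraph.fromEdgeSet (cubicLattice.edgeSet \ S)

lemma cut_adj {S : Set (Sym2 Site)} {x y : Site} :
    (cut S).Adj x y ↔ cubicLattice.Adj x y ∧ s(x, y) ∉ S := by
  rw [cut, SimpleGraph.fromEdgeSet_adj]
  exact ⟨fun h => h.1, fun h => ⟨h, h.1.ne⟩⟩

/-- No plaquette of `D` belongs to `H` or is 1-connected to an element of `H`. -/
def Separated (H D : Set (Sym2 Site)) : Prop :=
  ∀ d ∈ D, ∀ h ∈ H, d ≠ h ∧ ¬ OneConnected h d

lemma eq_of_reachable {V α : Type*} {G : SimpleGraph V} (f : V → α)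
    (h : ∀ a b, G.Adj a b → f a = f b) {a b : V} (hab : G.Reachable a b) : f a = f b := by
  obtain ⟨p⟩ := hab
  induction p with
  | nil => rfl
  | cons hadj _ ih => exact (h _ _ hadj).trans ih

/-- Whether the endpoints of a removed edge are separated is not affected by further removed
edges that are not 1-connected to those considered. -/
lemma reachable_cut_union_iff {H D : Set (Sym2 Site)} (hHD : Separated H D) {x y : Site}
    (hxy : cubicLattice.Adj x y) (hD : s(x, y) ∈ D) :
    (cut (H ∪ D)).Reachable x y ↔ (cut D).Reachable x y := by
  refine ⟨fun h => h.mono fun a b hab => ?_, fun h => ?_⟩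
  · rw [cut_adj] at hab ⊢
    exact ⟨hab.1, fun h => hab.2 (.inr h)⟩
  by_contra hn
  -- The coboundary of this indicator lives on H ∪ D. Its restriction to D is still closed, because
  -- a square with a side in D has no side in H. A potential of the restriction is constant along
  -- paths avoiding D, yet jumps across the edge xy.
  let f₀ : Site → ZMod 2 := fun v => if (cut (H ∪ D)).Reachable x v then 1 else 0
  have hf₀ : ∀ a b, (cut (H ∪ D)).Adj a b → f₀ a = f₀ b := by
    intro a b hab
    have : (cut (H ∪ D)).Reachable x a ↔ (cut (H ∪ D)).Reachable x b :=
      ⟨fun h => h.trans hab.reachable, fun h => h.trans hab.symm.reachable⟩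
    simp only [f₀, this]
  let c : Sym2 Site → ZMod 2 := Sym2.lift ⟨fun a b => f₀ a + f₀ b, fun a b => add_comm _ _⟩
  have hc : ∀ a b, c s(a, b) = f₀ a + f₀ b := fun a b => rfl
  obtain ⟨f, hf⟩ := exists_potential (fun e => if e ∈ D then c e else 0) (by
    intro v i j hij
    by_cases hsq : ∃ d ∈ squareSides v i j, d ∈ D
    · obtain ⟨d, hd, hdD⟩ := hsq
      have key : ∀ e ∈ squareSides v i j, (if e ∈ D then c e else 0) = c e := by
        intro e he
        split_ifs with heD
        · rfl
        · have heH : e ∉ H := by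
            intro heH
            exact (hHD d hdD e heH).2 ⟨(hHD d hdD e heH).1.symm, v, i, j, hij, he, hd⟩
          have heE := squareSides_subset v i j he
          induction e using Sym2.ind with
          | _ a b =>
            rw [hc, hf₀ a b (cut_adj.2 ⟨heE, fun h => h.elim heH heD⟩), CharTwo.add_self_eq_zero]
      simp only [squareSides, Set.mem_insert_iff, Set.mem_singleton_iff, forall_eq_or_imp,
        forall_eq] at key
      obtain ⟨k1, k2, k3, k4⟩ := key
      simp only [k1, k2, k3, k4]
      simp only [hc]
      linear_combination CharTwo.add_self_eq_zero (f₀ v) +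
        CharTwo.add_self_eq_zero (f₀ (v + Pi.single i 1)) +
        CharTwo.add_self_eq_zero (f₀ (v + Pi.single j 1)) +
        CharTwo.add_self_eq_zero (f₀ (v + Pi.single i 1 + Pi.single j 1))
    · have key : ∀ e ∈ squareSides v i j, (if e ∈ D then c e else 0) = 0 := by
        intro e he
        rw [if_neg fun h => hsq ⟨e, he, h⟩]
      simp only [squareSides, Set.mem_insert_iff, Set.mem_singleton_iff, forall_eq_or_imp,
        forall_eq] at key
      obtain ⟨k1, k2, k3, k4⟩ := key
      simp only [k1, k2, k3, k4, add_zero])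
  have hadj : ∀ a b, cubicLattice.Adj a b → f b = f a + if s(a, b) ∈ D then c s(a, b) else 0 := by
    intro a b hab
    obtain ⟨i, rfl | rfl⟩ := cubicLattice_adj_iff.1 hab
    · exact hf a i
    · rw [hf b i, Sym2.eq_swap (a := b), add_assoc, CharTwo.add_self_eq_zero, add_zero]
  have h1 : f x = f y := by
    refine eq_of_reachable f (fun a b hab => ?_) h
    rw [cut_adj] at hab
    rw [hadj a b hab.1, if_neg hab.2, add_zero]
  have h2 := hadj x y hxy
  rw [if_pos hD, hc, ← h1] at h2
  have h3 : f₀ x = 1 := if_pos .rfl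
  have h4 : f₀ y = 0 := if_neg hn
  rw [h3, h4] at h2
  simp at h2

/-- Adding an edge joins at most the two components of its endpoints. -/
lemma reachable_insert {V : Type*} {T : Set (Sym2 V)} {x y u v : V}
    (h : (SimpleGraph.fromEdgeSet (insert s(x, y) T)).Reachable u v) :
    (SimpleGraph.fromEdgeSet T).Reachable u v ∨
      ((SimpleGraph.fromEdgeSet T).Reachable u x ∧ (SimpleGraph.fromEdgeSet T).Reachable v y) ∨
      ((SimpleGraph.fromEdgeSet T).Reachable u y ∧
        (SimpleGraph.fromEdgeSet T).Reachable v x) := by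
  obtain ⟨p⟩ := h
  induction p with
  | nil => exact .inl .rfl
  | @cons a b d hab p ih =>
    rw [SimpleGraph.fromEdgeSet_adj, Set.mem_insert_iff] at hab
    obtain ⟨hab | hab, hne⟩ := hab
    · rcases Sym2.eq_iff.1 hab with ⟨rfl, rfl⟩ | ⟨rfl, rfl⟩
      · rcases ih with ih | ⟨h1, h2⟩ | ⟨h1, h2⟩
        · exact .inr (.inl ⟨.rfl, ih.symm⟩)
        · exact .inr (.inl ⟨.rfl, h2⟩)
        · exact .inl h2.symm
      · rcases ih with ih | ⟨h1, h2⟩ | ⟨h1, h2⟩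
        · exact .inr (.inr ⟨.rfl, ih.symm⟩)
        · exact .inl h2.symm
        · exact .inr (.inr ⟨.rfl, h2⟩)
    · have h : (SimpleGraph.fromEdgeSet T).Reachable a b :=
        SimpleGraph.Adj.reachable ((SimpleGraph.fromEdgeSet_adj _).2 ⟨hab, hne⟩)
      rcases ih with ih | ⟨h1, h2⟩ | ⟨h1, h2⟩
      · exact .inl (h.trans ih)
      · exact .inr (.inl ⟨h.trans h1, h2⟩)
      · exact .inr (.inr ⟨h.trans h1, h2⟩)

/-- The map on components is injective if `x` and `y` were already connected; otherwise it merges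
exactly their two components. Both are counted because `x` and `y` lie in `W`. -/
lemma ncard_components_insert {V : Type*} {T : Set (Sym2 V)} {x y : V} {W : Set V}
    (hW : W.Finite) (hx : x ∈ W) (hy : y ∈ W) (hxy : x ≠ y) :
    ((SimpleGraph.fromEdgeSet T).connectedComponentMk '' W).ncard =
      ((SimpleGraph.fromEdgeSet (insert s(x, y) T)).connectedComponentMk '' W).ncard +
        if (SimpleGraph.fromEdgeSet T).Reachable x y then 0 else 1 := by
  set G := SimpleGraph.fromEdgeSet T
  set G' := SimpleGraph.fromEdgeSet (insert s(x, y) T)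
  have hle : G ≤ G' := SimpleGraph.fromEdgeSet_mono (Set.subset_insert _ _)
  let π : G.ConnectedComponent → G'.ConnectedComponent :=
    SimpleGraph.ConnectedComponent.map (SimpleGraph.Hom.ofLE hle)
  have hπ : ∀ v, π (G.connectedComponentMk v) = G'.connectedComponentMk v := fun v => rfl
  have himg : G'.connectedComponentMk '' W = π '' (G.connectedComponentMk '' W) := by
    rw [Set.image_image]
    rfl
  have hfin : (G.connectedComponentMk '' W).Finite := hW.image _
  split_ifs with h
  · rw [himg, add_zero, Set.ncard_image_of_injective (G.connectedComponentMk '' W)]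
    intro a b
    refine SimpleGraph.ConnectedComponent.ind₂ (fun u v huv => ?_) a b
    rw [hπ, hπ, SimpleGraph.ConnectedComponent.eq] at huv
    rw [SimpleGraph.ConnectedComponent.eq]
    rcases reachable_insert huv with h1 | ⟨h1, h2⟩ | ⟨h1, h2⟩
    · exact h1
    · exact (h1.trans h).trans h2.symm
    · exact (h1.trans h.symm).trans h2.symm
  · have hyx : π (G.connectedComponentMk y) = π (G.connectedComponentMk x) := by
      rw [hπ, hπ, SimpleGraph.ConnectedComponent.eq]
      refine SimpleGraph.Adj.reachable ((SimpleGraph.fromEdgeSet_adj _).2 ⟨?_, hxy.symm⟩)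
      rw [Sym2.eq_swap]
      exact Set.mem_insert _ _
    have himg' : G'.connectedComponentMk '' W =
        π '' (G.connectedComponentMk '' W \ {G.connectedComponentMk y}) := by
      rw [himg]
      refine (Set.image_mono Set.sdiff_subset).antisymm' ?_
      rintro _ ⟨a, ha, rfl⟩
      by_cases hay : a = G.connectedComponentMk y
      · refine ⟨G.connectedComponentMk x, ⟨⟨x, hx, rfl⟩, ?_⟩, by rw [hay, hyx]⟩
        rw [Set.mem_singleton_iff, SimpleGraph.ConnectedComponent.eq]
        exact h
      · exact ⟨a, ⟨ha, hay⟩, rfl⟩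
    rw [himg', Set.InjOn.ncard_image (s := G.connectedComponentMk '' W \ _),
      Set.ncard_sdiff_singleton_add_one (Set.mem_image_of_mem _ hy) hfin]
    rintro a ⟨_, ha⟩ b ⟨_, hb⟩ hab
    induction a using SimpleGraph.ConnectedComponent.ind with | _ u =>
    induction b using SimpleGraph.ConnectedComponent.ind with | _ v =>
    rw [hπ, hπ, SimpleGraph.ConnectedComponent.eq] at hab
    rw [Set.mem_singleton_iff, SimpleGraph.ConnectedComponent.eq] at ha hb
    rw [SimpleGraph.ConnectedComponent.eq]
    rcases reachable_insert hab with h1 | ⟨h1, h2⟩ | ⟨h1, h2⟩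
    · exact h1
    · exact absurd h2 hb
    · exact absurd h1 ha

/-- The number of components of the lattice without `S` that meet `W`. -/
def numComponents (W : Set Site) (S : Set (Sym2 Site)) : ℕ :=
  ((cut S).connectedComponentMk '' W).ncard

lemma numComponents_insert {W : Set Site} (hW : W.Finite) {S : Set (Sym2 Site)} {x y : Site}
    (hx : x ∈ W) (hy : y ∈ W) (hxy : cubicLattice.Adj x y) (hS : s(x, y) ∉ S) :
    numComponents W (insert s(x, y) S) =
      numComponents W S + if (cut (insert s(x, y) S)).Reachable x y then 0 else 1 := by
  have h : cubicLattice.edgeSet \ S =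
      insert s(x, y) (cubicLattice.edgeSet \ insert s(x, y) S) := by
    ext e
    simp only [Set.mem_sdiff, Set.mem_insert_iff]
    constructor
    · rintro ⟨h1, h2⟩
      by_cases he : e = s(x, y)
      · exact .inl he
      · exact .inr ⟨h1, by tauto⟩
    · rintro (rfl | h)
      · exact ⟨hxy, hS⟩
      · exact ⟨h.1, by tauto⟩
  rw [numComponents, numComponents, cut, cut, h]
  exact ncard_components_insert hW hx hy hxy.ne

lemma Separated.mono {H D D' : Set (Sym2 Site)} (h : Separated H D) (hD : D' ⊆ D) :
    Separated H D' := fun d hd => h d (hD hd)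

/-- Additivity of the number of components created by separated sets of removed edges. -/
lemma numComponents_union {W : Set Site} (hW : W.Finite) {H : Set (Sym2 Site)}
    (D : Finset (Sym2 Site)) (hD : ↑D ⊆ cubicLattice.edgeSet) (hDW : ∀ e ∈ D, ∀ v ∈ e, v ∈ W)
    (hHD : Separated H D) :
    numComponents W (H ∪ D) + numComponents W ∅ = numComponents W H + numComponents W D := by
  induction D using Finset.induction_on with
  | empty => simp
  | insert e D he ih =>
    have hsub : (D : Set (Sym2 Site)) ⊆ ↑(insert e D) := by simp
    have ih' := ih (hsub.trans hD) (fun e' he' => hDW e' (Finset.mem_insert_of_mem he'))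
      (hHD.mono hsub)
    have heH : e ∉ H := fun h => (hHD e (by simp) e h).1 rfl
    have heE : e ∈ cubicLattice.edgeSet := hD (by simp)
    have heW := hDW e (Finset.mem_insert_self _ _)
    induction e using Sym2.ind with
    | _ x y =>
      have hx := heW x (Sym2.mem_mk_left _ _)
      have hy := heW y (Sym2.mem_mk_right _ _)
      have h1 := numComponents_insert hW (S := H ∪ D) hx hy heE (by
        rintro (h | h)
        · exact heH h
        · exact he h)
      have h2 := numComponents_insert hW (S := D) hx hy heE (by simpa using he)
      -- The new edge creates a component in the presence of `H` exactly when it does so without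
      -- `H`.
      have h3 := reachable_cut_union_iff hHD heE (by simp)
      rw [Finset.coe_insert] at h3 ⊢
      rw [Set.union_insert] at h3 ⊢
      simp only [h3] at h1
      omega

lemma reachable_cubicLattice (x y : Site) : cubicLattice.Reachable x y := by
  have hline : ∀ (i : Fin 3) (x : Site) (n : ℤ),
      cubicLattice.Reachable x (x + Pi.single i n) := by
    intro i x n
    induction n using Int.induction_on with
    | zero => simp
    | succ n ih =>
      refine ih.trans (SimpleGraph.Adj.reachable ?_)
      rw [Pi.single_add, ← add_assoc]
      exact adj_add_single _ _
    | pred n ih =>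
      refine ih.trans (SimpleGraph.Adj.reachable ?_)
      have := adj_add_single (x + Pi.single i (-(n : ℤ) - 1)) i
      rw [add_assoc, ← Pi.single_add, sub_add_cancel] at this
      exact this.symm
  have h : y = x + Pi.single 0 (y 0 - x 0) + Pi.single 1 (y 1 - x 1) + Pi.single 2 (y 2 - x 2) := by
    ext j; fin_cases j <;> simp
  rw [h]
  exact ((hline 0 _ _).trans (hline 1 _ _)).trans (hline 2 _ _)

/-- Every component of the lattice without `S` meets each nonempty set that contains the endpoints
of `S`. -/
lemma numComponents_eq_univ {W : Set Site} (hW : W.Nonempty) {S : Set (Sym2 Site)}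
    (hS : ∀ e ∈ S, ∀ v ∈ e, v ∈ W) : numComponents W S = numComponents Set.univ S := by
  rw [numComponents, numComponents]
  congr 1
  refine (Set.image_mono (Set.subset_univ _)).antisymm ?_
  rintro _ ⟨v, -, rfl⟩
  by_contra hv
  have hnot : ∀ u, (cut S).Reachable v u → u ∉ W := by
    intro u hu huW
    exact hv ⟨u, huW, (SimpleGraph.ConnectedComponent.eq.2 hu).symm⟩
  -- A component that misses `W` touches no removed edge, so it is closed under lattice adjacency
  -- and exhausts ℤ³.
  have hall : ∀ u, (cut S).Reachable v u := by
    intro u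
    have := eq_of_reachable (G := cubicLattice) (fun u => (cut S).Reachable v u) (by
      intro a b hab
      have key : ∀ a b, cubicLattice.Adj a b → (cut S).Reachable v a → (cut S).Reachable v b :=
        fun a b hab ha => ha.trans (SimpleGraph.Adj.reachable (cut_adj.2
          ⟨hab, fun h => hnot a ha (hS _ h a (Sym2.mem_mk_left _ _))⟩))
      exact propext ⟨key a b hab, key b a hab.symm⟩) (reachable_cubicLattice v u)
    exact this.mp .rfl
  obtain ⟨u, hu⟩ := hW
  exact hnot u (hall u) hu

lemma numComponents_empty {W : Set Site} (hW : W.Nonempty) : numComponents W ∅ = 1 := by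
  rw [numComponents, Set.ncard_eq_one]
  obtain ⟨u, hu⟩ := hW
  refine ⟨(cut ∅).connectedComponentMk u, ?_⟩
  have h : cut ∅ = cubicLattice := by
    ext a b
    simp [cut_adj]
  refine Set.eq_singleton_iff_unique_mem.2 ⟨⟨u, hu, rfl⟩, ?_⟩
  rintro _ ⟨v, -, rfl⟩
  rw [SimpleGraph.ConnectedComponent.eq, h]
  exact reachable_cubicLattice _ _

lemma numComponents_le {W : Set Site} (hW : W.Finite) (hW' : W.Nonempty) (D : Finset (Sym2 Site))
    (hD : ↑D ⊆ cubicLattice.edgeSet) (hDW : ∀ e ∈ D, ∀ v ∈ e, v ∈ W) :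
    numComponents W D ≤ D.card + 1 := by
  induction D using Finset.induction_on with
  | empty => simp [numComponents_empty hW']
  | insert e D he ih =>
    have hsub : (D : Set (Sym2 Site)) ⊆ ↑(insert e D) := by simp
    have ih' := ih (hsub.trans hD) (fun e' he' => hDW e' (Finset.mem_insert_of_mem he'))
    have heE : e ∈ cubicLattice.edgeSet := hD (by simp)
    have heW := hDW e (Finset.mem_insert_self _ _)
    rw [Finset.card_insert_of_notMem he]
    induction e using Sym2.ind with
    | _ x y =>
      have h2 := numComponents_insert hW (S := D) (heW x (Sym2.mem_mk_left _ _))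
        (heW y (Sym2.mem_mk_right _ _)) heE (by simpa using he)
      rw [Finset.coe_insert, h2]
      split_ifs <;> omega

lemma numComponents_pos {W : Set Site} (hW : W.Finite) (hW' : W.Nonempty) (S : Set (Sym2 Site)) :
    0 < numComponents W S := by
  rw [numComponents, Set.ncard_pos (hW.image _)]
  exact hW'.image _

end RandomCluster

/-! ### Telescoping of the logarithms of ratios. -/

namespace Polymer

open Finset
open scoped Classical

/-- The points of `S` are removed in the order of their keys. The induction adds the point of
largest key: it is removed last and leaves the earlier domains unchanged. -/
lemma sum_log_ratio {V κ : Type*} [DecidableEq V] [LinearOrder κ] {N : V → Finset V} {w : Finset V → ℝ}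
    (hw : IsMultiplicative N w) (key : V → κ) (Λ S : Finset V) (hS : S ⊆ Λ)
    (hkey : Set.InjOn key S) (R : V → Finset V)
    (hR : ∀ e v, v ∈ R e ↔ v ∈ Λ ∧ ¬ (v ∈ S ∧ key v < key e)) :
    ∑ e ∈ S, Real.log (ratio w e (R e)) =
      Real.log (xi w Λ) - Real.log (xi w (Λ \ S)) := by
  obtain rfl : R = fun e => Λ \ S.filter (key · < key e) := by
    ext e v
    simp only [hR, mem_sdiff, mem_filter]
  clear hR
  beta_reduce
  induction S using Finset.induction_on_max_value key with
  | empty => simp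
  | insert a s ha hmax ih =>
    have hlt : ∀ x ∈ s, key x < key a := fun x hx => (hmax x hx).lt_of_ne fun h =>
      ha (hkey (mem_insert_of_mem hx) (mem_insert_self _ _) h ▸ hx)
    have ih' := ih ((subset_insert _ _).trans hS)
      (hkey.mono (by simp))
    have h1 : (insert a s).filter (key · < key a) = s := by
      ext v
      simp only [mem_filter, mem_insert]
      constructor
      · rintro ⟨rfl | h, h2⟩
        · exact absurd h2 (lt_irrefl _)
        · exact h
      · exact fun h => ⟨.inr h, hlt v h⟩
    have h2 : ∀ e ∈ s, (insert a s).filter (key · < key e) = s.filter (key · < key e) := by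
      intro e he
      rw [filter_insert, if_neg (hlt e he).not_gt]
    have h3 : (Λ \ s).erase a = Λ \ insert a s := by
      ext v
      simp only [mem_sdiff, mem_insert, mem_erase]
      tauto
    rw [sum_insert ha, sum_congr rfl fun e he => by rw [h2 e he], ih', h1, ratio, h3,
      Real.log_div (xi_pos hw _).ne' (xi_pos hw _).ne']
    ring

end Polymer

/-! ### Plaquette neighbourhoods, translations, the polymer weight and the ordering of edges. -/

namespace RandomCluster

open Finset Polymer
open scoped Classical

lemma OneConnected.symm {e e' : Sym2 Site} (h : OneConnected e e') : OneConnected e' e := by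
  obtain ⟨h, x, i, j, hij, h1, h2⟩ := h
  exact ⟨h.symm, x, i, j, hij, h2, h1⟩

lemma OneConnected.abs_sub_le {e e' : Sym2 Site} (h : OneConnected e e') {u v : Site}
    (hu : u ∈ e) (hv : v ∈ e') (k : Fin 3) : |u k - v k| ≤ 1 := by
  obtain ⟨-, x, i, j, hij, he, he'⟩ := h
  have key : ∀ e ∈ squareSides x i j, ∀ v ∈ e, x k ≤ v k ∧ v k ≤ x k + 1 := by
    have hk : ¬(k = i ∧ k = j) := by rintro ⟨rfl, rfl⟩; exact hij rfl
    rintro e (rfl | rfl | rfl | rfl) v hv <;> rcases Sym2.mem_iff.1 hv with rfl | rfl <;>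
      (try simp only [Pi.add_apply, Pi.single_apply]) <;> (try split_ifs) <;>
      omega
  have h1 := key e he u hu
  have h2 := key e' he' v hv
  rw [abs_le]
  constructor <;> linarith

lemma exists_mem_sym2 (e : Sym2 Site) : ∃ a, a ∈ e := by
  induction e using Sym2.ind with
  | _ x y => exact ⟨x, Sym2.mem_mk_left _ _⟩

lemma setOf_oneConnected_subset {e : Sym2 Site} {a : Site} (ha : a ∈ e) :
    {e' | e' = e ∨ OneConnected e e'} ⊆
      (insert e (Finset.Icc (a - 1) (a + 1)).sym2 : Finset (Sym2 Site)) := by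
  rintro e' (rfl | h)
  · simp
  · rw [mem_coe, mem_insert]
    refine .inr (mem_sym2_iff.2 fun v hv => ?_)
    rw [Finset.mem_Icc]
    have hk := fun k => abs_le.1 (h.abs_sub_le ha hv k)
    exact ⟨fun k => by have := hk k; simp only [Pi.sub_apply, Pi.one_apply]; linarith,
      fun k => by have := hk k; simp only [Pi.add_apply, Pi.one_apply]; linarith⟩

lemma finite_setOf_oneConnected (e : Sym2 Site) :
    {e' | e' = e ∨ OneConnected e e'}.Finite :=
  (Finset.finite_toSet _).subset (setOf_oneConnected_subset (exists_mem_sym2 e).choose_spec)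

/-- The plaquettes that are equal or 1-connected to `e`. -/
def nbhd (e : Sym2 Site) : Finset (Sym2 Site) := (finite_setOf_oneConnected e).toFinset

lemma mem_nbhd {e e' : Sym2 Site} : e' ∈ nbhd e ↔ e' = e ∨ OneConnected e e' :=
  Set.Finite.mem_toFinset _

lemma isNbhd_nbhd : IsNbhd nbhd where
  self_mem e := mem_nbhd.2 (.inl rfl)
  symm a b h := by
    rw [mem_nbhd] at h ⊢
    exact h.imp Eq.symm OneConnected.symm

lemma exists_card_nbhd_le : ∃ M : ℕ, ∀ e, #(nbhd e) ≤ M := by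
  -- 379 = 1 + 378: the edge itself and the 28 · 27 / 2 unordered pairs, with repetition, from a
  -- cube of 27 sites.
  refine ⟨379, fun e => ?_⟩
  obtain ⟨a, ha⟩ := exists_mem_sym2 e
  have h : nbhd e ⊆ insert e (Finset.Icc (a - 1) (a + 1)).sym2 := fun e' he' =>
    mem_coe.1 (setOf_oneConnected_subset ha (mem_nbhd.1 he'))
  refine (card_le_card h).trans ((card_insert_le _ _).trans ?_)
  rw [card_sym2, Pi.card_Icc]
  have h3 : ∀ i, a i + 1 + 1 - (a i - 1) = 3 := fun i => by ring
  simp [h3, Nat.choose]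

lemma dist_center_le_one {e e' : Sym2 Site} (h : e' ∈ nbhd e) :
    dist (center e) (center e') ≤ 1 := by
  rcases mem_nbhd.1 h with rfl | h
  · simp
  rw [dist_pi_le_iff zero_le_one]
  intro k
  induction e using Sym2.ind with | _ x y =>
  induction e' using Sym2.ind with | _ x' y' =>
  have h1 := abs_le.1 (h.abs_sub_le (Sym2.mem_mk_left x y) (Sym2.mem_mk_left x' y') k)
  have h2 := abs_le.1 (h.abs_sub_le (Sym2.mem_mk_right x y) (Sym2.mem_mk_right x' y') k)
  have h3 : (-1 : ℝ) ≤ x k - x' k ∧ (x k - x' k : ℝ) ≤ 1 := by exact_mod_cast h1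
  have h4 : (-1 : ℝ) ≤ y k - y' k ∧ (y k - y' k : ℝ) ≤ 1 := by exact_mod_cast h2
  change dist ((2⁻¹ : ℝ) * (x k + y k)) ((2⁻¹ : ℝ) * (x' k + y' k)) ≤ 1
  rw [Real.dist_eq, abs_le]
  constructor <;> linarith

/-- Translation of edges as a permutation. -/
def translateEquiv (t : Site) : Sym2 Site ≃ Sym2 Site where
  toFun := translate t
  invFun := translate (-t)
  left_inv e := by
    induction e using Sym2.ind with | _ x y => simp [translate]
  right_inv e := by
    induction e using Sym2.ind with | _ x y => simp [translate]

lemma translateEquiv_mk (t x y : Site) : translateEquiv t s(x, y) = s(x + t, y + t) := rfl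

lemma translateEquiv_symm (t : Site) : (translateEquiv t).symm = translateEquiv (-t) := by
  ext e
  rfl

lemma adj_translate_iff (t : Site) {x y : Site} :
    cubicLattice.Adj (x + t) (y + t) ↔ cubicLattice.Adj x y := by
  change ∑ i, |(x + t) i - (y + t) i| = 1 ↔ ∑ i, |x i - y i| = 1
  simp

lemma translateEquiv_mem_edgeSet_iff (t : Site) {e : Sym2 Site} :
    translateEquiv t e ∈ cubicLattice.edgeSet ↔ e ∈ cubicLattice.edgeSet := by
  induction e using Sym2.ind with | _ x y =>
  exact adj_translate_iff t

lemma translateEquiv_mem_squareSides (t : Site) {e : Sym2 Site} {x : Site} {i j : Fin 3}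
    (h : e ∈ squareSides x i j) : translateEquiv t e ∈ squareSides (x + t) i j := by
  rcases h with rfl | rfl | rfl | rfl <;> rw [translateEquiv_mk] <;>
    simp only [squareSides, Set.mem_insert_iff, Set.mem_singleton_iff, add_right_comm _ _ t,
      true_or, or_true]

lemma OneConnected.translateEquiv {e e' : Sym2 Site} (h : OneConnected e e') (t : Site) :
    OneConnected (translateEquiv t e) (translateEquiv t e') := by
  obtain ⟨h, x, i, j, hij, h1, h2⟩ := h
  exact ⟨fun h' => h ((RandomCluster.translateEquiv t).injective h'), x + t, i, j, hij,
    translateEquiv_mem_squareSides t h1, translateEquiv_mem_squareSides t h2⟩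

lemma oneConnected_translateEquiv_iff (t : Site) {e e' : Sym2 Site} :
    OneConnected (translateEquiv t e) (translateEquiv t e') ↔ OneConnected e e' := by
  refine ⟨fun h => ?_, fun h => h.translateEquiv t⟩
  have := h.translateEquiv (-t)
  rwa [← translateEquiv_symm, Equiv.symm_apply_apply, Equiv.symm_apply_apply] at this

lemma nbhd_translateEquiv (t : Site) (e : Sym2 Site) :
    nbhd (translateEquiv t e) = (nbhd e).map (translateEquiv t).toEmbedding := by
  ext v
  obtain ⟨v, rfl⟩ := (translateEquiv t).surjective v
  rw [mem_map_equiv, Equiv.symm_apply_apply, mem_nbhd, mem_nbhd, oneConnected_translateEquiv_iff,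
    (translateEquiv t).injective.eq_iff]

lemma numComponents_translate (t : Site) (S : Set (Sym2 Site)) :
    numComponents Set.univ (translateEquiv t '' S) = numComponents Set.univ S := by
  have hcard : ∀ S, numComponents Set.univ S = Nat.card (cut S).ConnectedComponent := by
    intro S
    rw [numComponents, Set.image_univ, ← Set.ncard_univ]
    congr 1
    refine Set.eq_univ_of_forall fun c => ?_
    induction c using SimpleGraph.ConnectedComponent.ind with
    | _ v => exact ⟨v, rfl⟩
  let φ : cut S ≃g cut (translateEquiv t '' S) :=
    { Equiv.addRight t with
      map_rel_iff' := by
        intro a b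
        rw [cut_adj, cut_adj]
        change cubicLattice.Adj (a + t) (b + t) ∧ translateEquiv t s(a, b) ∉ _ ↔ _
        rw [adj_translate_iff, (translateEquiv t).injective.mem_set_image] }
  rw [hcard, hcard]
  exact (Nat.card_congr φ.connectedComponentEquiv).symm

/-- The weight of the set `D` of closed edges relative to the configuration without closed edges. -/
def polymerWeight (s q : ℝ) (D : Finset (Sym2 Site)) : ℝ :=
  if (D : Set (Sym2 Site)) ⊆ cubicLattice.edgeSet then
    s ^ #D * q ^ (numComponents Set.univ (D : Set (Sym2 Site)) - 1) else 0

/-- The origin and the endpoints of the edges in `D`. -/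
def endpoints (D : Finset (Sym2 Site)) : Set Site := insert 0 (⋃ e ∈ D, {v | v ∈ e})

lemma finite_endpoints (D : Finset (Sym2 Site)) : (endpoints D).Finite := by
  refine (Set.Finite.biUnion D.finite_toSet fun e _ => ?_).insert 0
  induction e using Sym2.ind with | _ x y =>
  refine (Set.toFinite {x, y}).subset fun v hv => ?_
  simpa using hv

lemma mem_endpoints {D : Finset (Sym2 Site)} {e : Sym2 Site} (he : e ∈ D) {v : Site}
    (hv : v ∈ e) : v ∈ endpoints D :=
  Set.mem_insert_of_mem _ (Set.mem_biUnion he hv)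

/-- The origin belongs to `endpoints` so that this also holds for empty `D`. -/
lemma nonempty_endpoints (D : Finset (Sym2 Site)) : (endpoints D).Nonempty := ⟨0, .inl rfl⟩

lemma numComponents_univ_pos (D : Finset (Sym2 Site)) :
    0 < numComponents Set.univ (D : Set (Sym2 Site)) := by
  rw [← numComponents_eq_univ (nonempty_endpoints D) fun e he v hv => mem_endpoints he hv]
  exact numComponents_pos (finite_endpoints D) (nonempty_endpoints D) _

lemma polymerWeight_translate (s q : ℝ) (t : Site) (D : Finset (Sym2 Site)) :
    polymerWeight s q (D.map (translateEquiv t).toEmbedding) = polymerWeight s q D := by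
  have hsub : ((D.map (translateEquiv t).toEmbedding : Finset (Sym2 Site)) : Set (Sym2 Site)) ⊆
      cubicLattice.edgeSet ↔ (D : Set (Sym2 Site)) ⊆ cubicLattice.edgeSet := by
    rw [coe_map, Set.image_subset_iff]
    exact forall₂_congr fun e _ => translateEquiv_mem_edgeSet_iff t
  have hnum := numComponents_translate t (D : Set (Sym2 Site))
  rw [polymerWeight, polymerWeight, card_map]
  simp only [hsub]
  rw [coe_map, Equiv.coe_toEmbedding, hnum]

lemma separated_of_disjoint {γ D : Finset (Sym2 Site)} (h : Disjoint D (γ.biUnion nbhd)) :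
    Separated (γ : Set (Sym2 Site)) D := by
  intro d hd c hc
  have hn : d ∉ nbhd c := fun hdc => disjoint_left.1 h hd (mem_biUnion.2 ⟨c, hc, hdc⟩)
  rw [mem_nbhd, not_or] at hn
  exact hn

/-- Additivity of component counts, applied on the finite set of all endpoints, makes the exponent
of q additive. Subtracting 1 removes the component already present when nothing is cut. -/
lemma isMultiplicative_polymerWeight {s q : ℝ} (hs : 0 ≤ s) (hq : 0 ≤ q) :
    IsMultiplicative nbhd (polymerWeight s q) where
  empty := by simp [polymerWeight, numComponents_empty]
  nonneg D := by
    rw [polymerWeight]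
    split_ifs
    · positivity
    · rfl
  union γ D h := by
    rw [polymerWeight, polymerWeight, polymerWeight, coe_union]
    by_cases hγ : (γ : Set (Sym2 Site)) ⊆ cubicLattice.edgeSet
    · by_cases hD : (D : Set (Sym2 Site)) ⊆ cubicLattice.edgeSet
      · rw [if_pos hγ, if_pos hD, if_pos (Set.union_subset hγ hD)]
        set W := endpoints (γ ∪ D)
        have hW : ∀ S : Finset (Sym2 Site), S ⊆ γ ∪ D →
            numComponents W S = numComponents Set.univ (S : Set (Sym2 Site)) := fun S hS =>
          numComponents_eq_univ (nonempty_endpoints _) fun e he v hv => mem_endpoints (hS he) hv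
        have hadd := numComponents_union (finite_endpoints (γ ∪ D)) D hD
          (fun e he v hv => mem_endpoints (mem_union_right _ he) hv) (separated_of_disjoint h)
        rw [← coe_union, hW _ subset_rfl, hW _ subset_union_left, hW _ subset_union_right,
          numComponents_empty (nonempty_endpoints _)] at hadd
        have h1 := numComponents_univ_pos γ
        have h2 := numComponents_univ_pos D
        have hcard : #(γ ∪ D) = #γ + #D :=
          card_union_of_disjoint (h.symm.mono_left (subset_biUnion_nbhd isNbhd_nbhd γ))
        rw [← coe_union, hcard, show numComponents Set.univ ((γ ∪ D : Finset (Sym2 Site)) :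
          Set (Sym2 Site)) - 1 = (numComponents Set.univ (γ : Set (Sym2 Site)) - 1) +
          (numComponents Set.univ (D : Set (Sym2 Site)) - 1) by omega, pow_add, pow_add]
        ring
      · rw [if_neg hD, if_neg fun h' => hD (Set.subset_union_right.trans h'), mul_zero]
    · rw [if_neg hγ, if_neg fun h' => hγ (Set.subset_union_left.trans h'), zero_mul]

/-- Each removed edge creates at most one component, hence at most one factor q. -/
lemma polymerWeight_le {s q : ℝ} (hs : 0 ≤ s) (hq : 1 ≤ q) (D : Finset (Sym2 Site)) :
    polymerWeight s q D ≤ (s * q) ^ #D := by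
  rw [polymerWeight]
  split_ifs with hD
  · rw [mul_pow]
    have := numComponents_le (finite_endpoints D) (nonempty_endpoints D) D hD
      fun e he v hv => mem_endpoints he hv
    rw [numComponents_eq_univ (nonempty_endpoints D) fun e he v hv => mem_endpoints he hv] at this
    exact mul_le_mul_of_nonneg_left (pow_le_pow_right₀ hq (by omega)) (by positivity)
  · positivity

/-- The sum of the endpoints of an edge, ordered lexicographically. -/
def edgeKey : Sym2 Site → Lex Site :=
  Sym2.lift ⟨fun x y => toLex (x + y), fun x y => congrArg toLex (add_comm x y)⟩

lemma edgeKey_mk (x y : Site) : edgeKey s(x, y) = toLex (x + y) := rfl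

lemma edgeKey_translateEquiv (t : Site) (e : Sym2 Site) :
    edgeKey (translateEquiv t e) = edgeKey e + toLex (t + t) := by
  induction e using Sym2.ind with | _ x y =>
  rw [translateEquiv_mk, edgeKey_mk, edgeKey_mk, ← toLex_add, add_add_add_comm]

/-- Translation invariance of the removal order makes the interaction translation invariant. -/
lemma edgeKey_translateEquiv_lt_iff (t : Site) (e e' : Sym2 Site) :
    edgeKey (translateEquiv t e) < edgeKey (translateEquiv t e') ↔ edgeKey e < edgeKey e' := by
  rw [edgeKey_translateEquiv, edgeKey_translateEquiv, add_lt_add_iff_right]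

lemma exists_eq_of_mem_edgeSet {e : Sym2 Site} (he : e ∈ cubicLattice.edgeSet) :
    ∃ x i, e = s(x, x + Pi.single i 1) := by
  induction e using Sym2.ind with | _ x y =>
  have hadj : cubicLattice.Adj x y := he
  obtain ⟨i, rfl | rfl⟩ := cubicLattice_adj_iff.1 hadj
  · exact ⟨x, i, rfl⟩
  · exact ⟨y, i, Sym2.eq_swap⟩

/-- The only odd coordinate of the sum of the endpoints reveals the direction of the edge, and the
sum then gives its base point. -/
lemma injOn_edgeKey : Set.InjOn edgeKey cubicLattice.edgeSet := by
  intro e he e' he' h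
  obtain ⟨x, i, rfl⟩ := exists_eq_of_mem_edgeSet he
  obtain ⟨y, j, rfl⟩ := exists_eq_of_mem_edgeSet he'
  rw [edgeKey_mk, edgeKey_mk, toLex_inj] at h
  have hk : ∀ k, x k + (x k + (Pi.single i 1 : Site) k) =
    y k + (y k + (Pi.single j 1 : Site) k) := fun k => congrFun h k
  have hij : i = j := by
    by_contra hij
    have := hk i
    rw [Pi.single_eq_same, Pi.single_eq_of_ne hij] at this
    omega
  subst hij
  have hxy : x = y := by
    ext k
    have := hk k
    omega
  rw [hxy]

end RandomCluster

/-! ### The interaction: size, locality, translation invariance and total. -/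

namespace RandomCluster

open Finset Polymer
open scoped Classical

/-- The closure of the plaquette set `F` within the edge set `E`. -/
def closureIn (E F : Set (Sym2 Site)) : Set (Sym2 Site) :=
  {e | e ∈ E ∧ (e ∈ F ∨ ∃ f ∈ F, OneConnected f e)}

lemma mem_closureIn {E F : Set (Sym2 Site)} {e : Sym2 Site} :
    e ∈ closureIn E F ↔ e ∈ E ∧ ∃ f ∈ nbhd e, f ∈ F := by
  refine and_congr_right fun _ => ⟨?_, ?_⟩
  · rintro (h | ⟨f, hf, h⟩)
    · exact ⟨e, isNbhd_nbhd.self_mem e, h⟩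
    · exact ⟨f, mem_nbhd.2 (.inr h.symm), hf⟩
  · rintro ⟨f, hf, h⟩
    rcases mem_nbhd.1 hf with rfl | hfe
    · exact .inl h
    · exact .inr ⟨f, h, hfe.symm⟩

/-- The edges of `E` without those plaquettes of the closure of `F` that precede `e`. -/
def remaining (E F : Set (Sym2 Site)) (e : Sym2 Site) : Set (Sym2 Site) :=
  {v | v ∈ E ∧ ¬ (v ∈ closureIn E F ∧ edgeKey v < edgeKey e)}

/-- The contribution of the plaquette `f` to the interaction of the plaquette set `F`: each
plaquette of the closure of `F` is shared evenly among the elements of `F` next to it. -/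
def interaction (w : Finset (Sym2 Site) → ℝ) (b : ℝ) (f : Sym2 Site) (F E : Set (Sym2 Site)) : ℝ :=
  ∑ e ∈ (nbhd f).filter (· ∈ E),
    (#((nbhd e).filter (· ∈ F)) : ℝ)⁻¹ * (b - logRatio w e (remaining E F e))

variable {w : Finset (Sym2 Site) → ℝ} {b y θ : ℝ} {M : ℕ}

lemma abs_interaction_le (hM : ∀ e, #(nbhd e) ≤ M) (hw : IsMultiplicative nbhd w)
    (hy : 0 ≤ y) (hy1 : 2 ^ M * y ≤ 1) (hwy : ∀ D, w D ≤ y ^ #D) (f : Sym2 Site)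
    (F E : Set (Sym2 Site)) :
    |interaction w b f F E| ≤ M * (|b| + 2 ^ M * y) := by
  refine (abs_sum_le_sum_abs _ _).trans ?_
  calc _ ≤ ∑ e ∈ (nbhd f).filter (· ∈ E), (|b| + 2 ^ M * y) := by
        refine sum_le_sum fun e _ => ?_
        rw [abs_mul, abs_of_nonneg (by positivity)]
        refine (mul_le_of_le_one_left (abs_nonneg _) (Nat.cast_inv_le_one _)).trans ?_
        refine (abs_sub _ _).trans ?_
        gcongr
        exact abs_logRatio_le isNbhd_nbhd hM hw hy hy1 hwy _ _
    _ ≤ M * (|b| + 2 ^ M * y) := by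
        rw [sum_const, nsmul_eq_mul]
        gcongr
        exact (card_filter_le _ _).trans (hM f)

/-- The margin 2 in `hn`: the edges `e` lie within distance 1 of `f`, and membership in the closure
of `F` looks one step beyond the radius n about `e`. -/
lemma abs_interaction_sub_le (hM : ∀ e, #(nbhd e) ≤ M) (hw : IsMultiplicative nbhd w)
    (hy : 0 ≤ y) (hy1 : 2 ^ M * y ≤ 1) (hwy : ∀ D, w D ≤ y ^ #D) (hθ : 0 < θ) (hθ1 : θ ≤ 1)
    (hyθ : 2 ^ M * (2 * M * y) ≤ θ) {f : Sym2 Site} {F E F' E' : Set (Sym2 Site)} {r : ℝ}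
    (n : ℕ) (hn : n + 2 ≤ r) (hE : ∀ e, dist (center f) (center e) ≤ r → (e ∈ E ↔ e ∈ E'))
    (hF : ∀ e, dist (center f) (center e) ≤ r → (e ∈ F ↔ e ∈ F')) :
    |interaction w b f F E - interaction w b f F' E'| ≤ M * θ ^ n := by
  have hn0 : (0 : ℝ) ≤ n := Nat.cast_nonneg n
  have h1 : (nbhd f).filter (· ∈ E) = (nbhd f).filter (· ∈ E') :=
    filter_congr fun e he => hE e ((dist_center_le_one he).trans (by linarith))
  have hdist : ∀ {e v : Sym2 Site}, e ∈ nbhd f →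
      dist (center f) (center v) ≤ 1 + dist (center e) (center v) := fun {e v} he =>
    (dist_triangle _ (center e) _).trans (by gcongr; exact dist_center_le_one he)
  rw [interaction, interaction, ← h1, ← sum_sub_distrib]
  refine (abs_sum_le_sum_abs _ _).trans ?_
  calc _ ≤ ∑ e ∈ (nbhd f).filter (· ∈ E), θ ^ n := by
        refine sum_le_sum fun e he => ?_
        have he := (mem_filter.1 he).1
        have h2 : (nbhd e).filter (· ∈ F) = (nbhd e).filter (· ∈ F') :=
          filter_congr fun v hv => hF v ((hdist he).trans (by linarith [dist_center_le_one hv]))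
        rw [← h2, ← mul_sub, abs_mul, abs_of_nonneg (by positivity), sub_sub_sub_cancel_left,
          abs_sub_comm]
        refine (mul_le_of_le_one_left (abs_nonneg _) (Nat.cast_inv_le_one _)).trans ?_
        refine abs_logRatio_sub_le isNbhd_nbhd hM (fun _ _ h => dist_center_le_one h) hw hy hy1 hwy
          hθ hθ1 hyθ n e _ _ fun v hv => ?_
        have hv' : dist (center f) (center v) + 1 ≤ r := by
          linarith [hdist (v := v) he]
        have hvE := hE v (by linarith)
        have hvC : v ∈ closureIn E F ↔ v ∈ closureIn E' F' := by
          rw [mem_closureIn, mem_closureIn, hvE]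
          refine and_congr_right fun _ => exists_congr fun g => and_congr_right fun hg => ?_
          refine hF g ((dist_triangle _ (center v) _).trans ?_)
          linarith [dist_center_le_one hg]
        simp only [remaining, Set.mem_ofPred_eq, hvE, hvC]
    _ ≤ M * θ ^ n := by
        rw [sum_const, nsmul_eq_mul]
        gcongr
        exact (card_filter_le _ _).trans (hM f)

lemma closureIn_image (t : Site) (E F : Set (Sym2 Site)) :
    closureIn (translateEquiv t '' E) (translateEquiv t '' F) =
      translateEquiv t '' closureIn E F := by
  ext v
  obtain ⟨v, rfl⟩ := (translateEquiv t).surjective v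
  rw [mem_closureIn, (translateEquiv t).injective.mem_set_image,
    (translateEquiv t).injective.mem_set_image, mem_closureIn, nbhd_translateEquiv]
  refine and_congr_right fun _ => ?_
  simp only [mem_map, exists_exists_and_eq_and, Equiv.coe_toEmbedding,
    (translateEquiv t).injective.mem_set_image]

lemma interaction_image (t : Site)
    (hτ : ∀ D : Finset (Sym2 Site), w (D.map (translateEquiv t).toEmbedding) = w D)
    (f : Sym2 Site) (F E : Set (Sym2 Site)) :
    interaction w b (translateEquiv t f) (translateEquiv t '' F) (translateEquiv t '' E) =
      interaction w b f F E := by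
  have hfilter : ∀ (e : Sym2 Site) (S : Set (Sym2 Site)),
      (nbhd (translateEquiv t e)).filter (· ∈ translateEquiv t '' S) =
        ((nbhd e).filter (· ∈ S)).map (translateEquiv t).toEmbedding := by
    intro e S
    rw [nbhd_translateEquiv]
    ext v
    simp only [mem_filter, mem_map_equiv, Set.mem_image_equiv]
  rw [interaction, interaction, hfilter, sum_map]
  refine sum_congr rfl fun e _ => ?_
  have hrem : remaining (translateEquiv t '' E) (translateEquiv t '' F) (translateEquiv t e) =
      translateEquiv t '' remaining E F e := by
    ext v
    obtain ⟨v, rfl⟩ := (translateEquiv t).surjective v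
    simp only [remaining, closureIn_image, Set.mem_ofPred_eq, edgeKey_translateEquiv_lt_iff,
      (translateEquiv t).injective.mem_set_image]
  rw [Equiv.coe_toEmbedding, hfilter, card_map, hrem, logRatio_image _ hτ]

/-- After exchanging the sums, the shares of each `e` in the closure add up to 1, because `e` has a
neighbour in `F`. The logarithms then telescope. -/
lemma sum_interaction (hw : IsMultiplicative nbhd w) {E F : Set (Sym2 Site)}
    (E₀ F₀ C : Finset (Sym2 Site)) (hE : E ⊆ cubicLattice.edgeSet) (hE₀ : ↑E₀ = E) (hF₀ : ↑F₀ = F)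
    (hC : ↑C = closureIn E F) :
    ∑ f ∈ F₀, interaction w b f F E =
      #C * b + Real.log (xi w (E₀ \ C)) - Real.log (xi w E₀) := by
  have hmemE : ∀ e, e ∈ E₀ ↔ e ∈ E := fun e => by rw [← hE₀, mem_coe]
  have hmemF : ∀ e, e ∈ F₀ ↔ e ∈ F := fun e => by rw [← hF₀, mem_coe]
  have hmemC : ∀ e, e ∈ C ↔ e ∈ closureIn E F := fun e => by rw [← hC, mem_coe]
  have hCE : C ⊆ E₀ := fun e he => (hmemE e).2 ((hmemC e).1 he).1
  have hswap : ∀ f e, f ∈ F₀ ∧ e ∈ (nbhd f).filter (· ∈ E) ↔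
      f ∈ (nbhd e).filter (· ∈ F) ∧ e ∈ C := by
    intro f e
    rw [mem_filter, mem_filter, hmemC, mem_closureIn, hmemF]
    constructor
    · rintro ⟨hf, hef, he⟩
      exact ⟨⟨isNbhd_nbhd.symm _ _ hef, hf⟩, he, f, isNbhd_nbhd.symm _ _ hef, hf⟩
    · rintro ⟨⟨hfe, hf⟩, he, -⟩
      exact ⟨hf, isNbhd_nbhd.symm _ _ hfe, he⟩
  have hlog := sum_log_ratio hw edgeKey E₀ C hCE
    (injOn_edgeKey.mono (((coe_subset.2 hCE).trans hE₀.subset).trans hE))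
    (fun e => E₀.filter (· ∈ remaining E F e)) (fun e v => by
      rw [mem_filter, hmemE, hmemC]
      exact ⟨fun h => h.2, fun h => ⟨h.1, h⟩⟩)
  simp only [interaction]
  rw [sum_comm' hswap]
  calc _ = ∑ e ∈ C, (b - Real.log (ratio w e (E₀.filter (· ∈ remaining E F e)))) := by
        refine sum_congr rfl fun e he => ?_
        have hrem : ((E₀.filter (· ∈ remaining E F e) : Finset (Sym2 Site)) : Set (Sym2 Site)) =
            remaining E F e := by
          ext v
          rw [mem_coe, mem_filter, hmemE]
          exact ⟨fun h => h.2, fun h => ⟨h.1, h⟩⟩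
        rw [sum_const, nsmul_eq_mul, ← mul_assoc, mul_inv_cancel₀, one_mul, ← logRatio_coe, hrem]
        obtain ⟨-, f, hf, hfF⟩ := mem_closureIn.1 ((hmemC e).1 he)
        exact Nat.cast_ne_zero.2 (card_pos.2 ⟨f, mem_filter.2 ⟨hf, hfF⟩⟩).ne'
    _ = _ := by
        rw [sum_sub_distrib, hlog, sum_const, nsmul_eq_mul]
        ring

/-! ### From random-cluster weights to polymer weights. -/

/-- The closed edges: those dual to `F` and those closed by the boundary condition. -/
def closedEdges (U : cubicLattice.Subgraph) (η F : Set (Sym2 Site)) : Set (Sym2 Site) :=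
  F ∪ (cubicLattice.edgeSet \ U.edgeSet) \ η

lemma numClusters_sdiff_union (U : cubicLattice.Subgraph) (η F D : Set (Sym2 Site))
    (hF : F ⊆ U.edgeSet) (hD : D ⊆ U.edgeSet) :
    numClusters U η (U.edgeSet \ (F ∪ D)) = numComponents U.verts (closedEdges U η F ∪ D) := by
  have hUE := U.edgeSet_subset
  have h : openGraph U η (U.edgeSet \ (F ∪ D)) = cut (closedEdges U η F ∪ D) := by
    rw [openGraph, cut]
    congr 1
    ext e
    have h1 := @hF e
    have h2 := @hD e
    have h3 := @hUE e
    simp only [closedEdges, Set.mem_union, Set.mem_inter_iff, Set.mem_sdiff]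
    tauto
  rw [numClusters, numComponents, h]

lemma separated_closedEdges {U : cubicLattice.Subgraph} {η F : Set (Sym2 Site)}
    (h : Compatible U η F) {D : Set (Sym2 Site)} (hD : D ⊆ U.edgeSet \ plaqClosure U F) :
    Separated (closedEdges U η F) D := by
  rintro d hd c (hc | hc)
  · refine ⟨?_, fun hcd => (hD hd).2 ⟨(hD hd).1, .inr ⟨c, hc, hcd⟩⟩⟩
    rintro rfl
    exact (hD hd).2 ⟨(hD hd).1, .inl hc⟩
  · refine ⟨?_, fun hcd => (hD hd).2 (h.2 c hc.1.1 hc.1.2 hc.2 d (hD hd).1 hcd)⟩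
    rintro rfl
    exact hc.1.2 (hD hd).1

lemma mem_verts_of_mem_edgeSet {U : cubicLattice.Subgraph} {e : Sym2 Site} (he : e ∈ U.edgeSet)
    {v : Site} (hv : v ∈ e) : v ∈ U.verts :=
  U.mem_verts_of_mem_edge he hv

/-- Compatibility separates `D` from all other closed edges, including those of η. Its effect on the
cluster count thus depends on neither `U` nor η. -/
lemma numClusters_eq {U : cubicLattice.Subgraph} (hU : U.verts.Finite) (hU' : U.verts.Nonempty)
    {η F : Set (Sym2 Site)} (h : Compatible U η F) (D : Finset (Sym2 Site))
    (hD : (D : Set (Sym2 Site)) ⊆ U.edgeSet \ plaqClosure U F) :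
    numClusters U η (U.edgeSet \ (F ∪ D)) =
      kappa U η F + (numComponents Set.univ (D : Set (Sym2 Site)) - 1) := by
  have hDU : (D : Set (Sym2 Site)) ⊆ U.edgeSet := hD.trans Set.sdiff_subset
  have h1 := numComponents_union hU D (hDU.trans U.edgeSet_subset)
    (fun e he v hv => mem_verts_of_mem_edgeSet (hDU he) hv) (separated_closedEdges h hD)
  have h2 := numClusters_sdiff_union U η F ∅ h.1 (Set.empty_subset _)
  rw [Set.union_empty, Set.union_empty] at h2
  have h3 := numComponents_univ_pos D
  rw [numComponents_empty hU',
    numComponents_eq_univ hU' (S := (D : Set (Sym2 Site))) (fun e he v hv =>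
      mem_verts_of_mem_edgeSet (hDU he) hv)] at h1
  rw [numClusters_sdiff_union U η F D h.1 hDU, kappa, h2]
  omega

lemma finite_edgeSet {U : cubicLattice.Subgraph} (hU : U.verts.Finite) : U.edgeSet.Finite := by
  refine (hU.toFinset.sym2.finite_toSet).subset fun e he => ?_
  rw [mem_coe, mem_sym2_iff]
  exact fun v hv => hU.mem_toFinset.2 (mem_verts_of_mem_edgeSet he hv)

/-- The total weight of the configurations in which `F` is closed and its boundary is open. -/
lemma finsum_weight_Cl {U : cubicLattice.Subgraph} (hU : U.verts.Finite) (hU' : U.verts.Nonempty)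
    {η : Set (Sym2 Site)} {E F C : Finset (Sym2 Site)} (hE : (E : Set (Sym2 Site)) = U.edgeSet)
    (hC : (C : Set (Sym2 Site)) = plaqClosure U F) (h : Compatible U η F) {p q : ℝ} (hp : p ≠ 0) :
    ∑ᶠ ω ∈ {ω : Set (Sym2 Site) | ω ⊆ U.edgeSet ∧ ω ∈ Cl U F}, weight p q U η ω =
      p ^ (#E - #F) * (1 - p) ^ #F * q ^ kappa U η F *
        xi (polymerWeight ((1 - p) / p) q) (E \ C) := by
  have hFE : F ⊆ E := by rw [← coe_subset, hE]; exact h.1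
  have hCE : C ⊆ E := by rw [← coe_subset, hE, hC]; exact fun e he => he.1
  have hFC : F ⊆ C := by
    rw [← coe_subset, hC]
    exact fun e he => ⟨h.1 he, .inl he⟩
  -- Configurations in the event are parametrized by their closed edges `D` outside the closure of
  -- `F`.
  let φ : Finset (Sym2 Site) → Set (Sym2 Site) := fun D => ↑(E \ (F ∪ D))
  have hset : {ω : Set (Sym2 Site) | ω ⊆ U.edgeSet ∧ ω ∈ Cl U F} =
      φ '' ((E \ C).powerset : Set (Finset (Sym2 Site))) := by
    ext ω
    constructor
    · rintro ⟨hωE, hωF, hωC⟩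
      refine ⟨(E \ F).filter (· ∉ ω), ?_, ?_⟩
      · rw [mem_coe, mem_powerset]
        intro e he
        rw [mem_filter, mem_sdiff] at he
        rw [mem_sdiff]
        refine ⟨he.1.1, fun heC => he.2 (hωC e ⟨?_, he.1.2⟩)⟩
        rw [← hC]
        exact heC
      · ext e
        have h1 := @hωE e
        have h2 := hωF e
        rw [← hE] at h1
        simp only [φ, mem_coe, mem_sdiff, mem_union, mem_filter] at h1 h2 ⊢
        tauto
    · rintro ⟨D, hD, rfl⟩
      rw [mem_coe, mem_powerset] at hD
      refine ⟨?_, fun e he => ?_, fun e he => ?_⟩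
      · rw [← hE]
        exact coe_subset.2 sdiff_subset
      · have : e ∈ F := he
        simp [φ, this]
      · obtain ⟨he1, he2⟩ := he
        rw [← hC] at he1
        have he3 : e ∉ D := fun heD => (mem_sdiff.1 (hD heD)).2 he1
        have he4 : e ∈ E := hCE he1
        have he5 : e ∉ F := he2
        simp [φ, he3, he4, he5]
  have hsdiff : ∀ D ∈ (E \ C).powerset, E \ (E \ (F ∪ D)) = F ∪ D := by
    intro D hD
    rw [mem_powerset] at hD
    exact Finset.sdiff_sdiff_eq_self (union_subset hFE (hD.trans sdiff_subset))
  have hdisj : ∀ D ∈ (E \ C).powerset, Disjoint F D := by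
    intro D hD
    rw [mem_powerset] at hD
    exact disjoint_left.2 fun e he he' => (mem_sdiff.1 (hD he')).2 (hFC he)
  have hinj : Set.InjOn φ ((E \ C).powerset : Set (Finset (Sym2 Site))) := by
    intro D hD D' hD' hDD
    have h1 : E \ (F ∪ D) = E \ (F ∪ D') := coe_injective hDD
    have h2 : F ∪ D = F ∪ D' := by rw [← hsdiff D hD, ← hsdiff D' hD', h1]
    have h3 := union_sdiff_cancel_left (hdisj D hD)
    have h4 := union_sdiff_cancel_left (hdisj D' hD')
    rw [← h3, ← h4, h2]
  rw [hset, finsum_mem_image hinj, finsum_mem_coe_finset, xi, mul_sum]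
  refine sum_congr rfl fun D hD => ?_
  have hDE := (mem_powerset.1 hD)
  have hDU : (D : Set (Sym2 Site)) ⊆ U.edgeSet \ plaqClosure U F := by
    rw [← hE, ← hC, ← coe_sdiff]
    exact coe_subset.2 hDE
  have hlat : (D : Set (Sym2 Site)) ⊆ cubicLattice.edgeSet :=
    (hDU.trans Set.sdiff_subset).trans U.edgeSet_subset
  have hcard : #(F ∪ D) = #F + #D := card_union_of_disjoint (hdisj D hD)
  have hcard' : #(E \ (F ∪ D)) + #D = #E - #F := by
    have hsub : F ∪ D ⊆ E := union_subset hFE (hDE.trans sdiff_subset)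
    have := card_sdiff_add_card_eq_card hsub
    omega
  have hnum : numClusters U η (φ D) =
      kappa U η F + (numComponents Set.univ (D : Set (Sym2 Site)) - 1) := by
    rw [← numClusters_eq hU hU' h D hDU, ← hE]
    simp [φ]
  rw [weight, hnum, ← hE]
  simp only [φ]
  rw [← coe_sdiff, hsdiff D hD, Set.ncard_coe_finset, Set.ncard_coe_finset, hcard, ← hcard',
    polymerWeight, if_pos hlat, div_pow, pow_add, pow_add, pow_add]
  field_simp

end RandomCluster

/-! ### The probability formula and the low-temperature constants. -/

namespace RandomCluster

open Finset Polymer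
open scoped Classical

/-- The law of the plaquettes of a compatible set in terms of the interaction. -/
lemma prob_Cl_eq {U : cubicLattice.Subgraph} (hU : U.verts.Finite) (hU' : U.verts.Nonempty)
    {η F : Set (Sym2 Site)} (h : Compatible U η F) {β q : ℝ} (hβ : 0 < β) (hq : 1 ≤ q) :
    prob (1 - Real.exp (-β)) q U η (Cl U F) =
      partitionFunction (1 - Real.exp (-β)) q U wired /
          partitionFunction (1 - Real.exp (-β)) q U η *
        (1 - Real.exp (-β)) ^ (plaqBoundary U F).ncard * Real.exp (-β * F.ncard) *
        q ^ ((kappa U η F : ℤ) - 1) *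
        Real.exp (∑ᶠ f ∈ F, interaction (polymerWeight (Real.exp (-β) / (1 - Real.exp (-β))) q)
          (-Real.log (1 - Real.exp (-β))) f F U.edgeSet) := by
  set p := 1 - Real.exp (-β) with hp
  have hpβ : Real.exp (-β) = 1 - p := by rw [hp]; ring
  have hp0 : 0 < p := by
    have : Real.exp (-β) < 1 := by simpa using hβ
    linarith
  have hp1 : 0 ≤ 1 - p := hpβ ▸ (Real.exp_pos _).le
  have hEfin := finite_edgeSet hU
  obtain ⟨E, hE⟩ := hEfin.exists_finset_coe
  obtain ⟨F, rfl⟩ := (hEfin.subset h.1).exists_finset_coe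
  obtain ⟨C, hC⟩ := (hEfin.subset fun e (he : e ∈ plaqClosure U F) => he.1).exists_finset_coe
  have hCE : C ⊆ E := by rw [← coe_subset, hE, hC]; exact fun e he => he.1
  have hFC : F ⊆ C := by
    rw [← coe_subset, hC]
    exact fun e he => ⟨h.1 he, .inl he⟩
  rw [hpβ]
  set w := polymerWeight ((1 - p) / p) q
  have hw : IsMultiplicative nbhd w :=
    isMultiplicative_polymerWeight (div_nonneg hp1 hp0.le) (by linarith)
  have hnum : ∑ᶠ ω ∈ {ω : Set (Sym2 Site) | ω ⊆ U.edgeSet ∧ ω ∈ Cl U F}, weight p q U η ω =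
      p ^ (#E - #F) * (1 - p) ^ #F * q ^ kappa U η F * xi w (E \ C) :=
    finsum_weight_Cl hU hU' hE hC h hp0.ne'
  -- Wired boundary conditions close no edge, so the empty set is compatible and Z^w is the same sum
  -- with empty closure.
  have hcompat : Compatible U wired (∅ : Finset (Sym2 Site)) := by
    refine ⟨by simp, fun e he _ hne => absurd he hne⟩
  have hkappa : kappa U wired (∅ : Finset (Sym2 Site)) = 1 := by
    have h1 := numClusters_sdiff_union U wired ∅ ∅ (Set.empty_subset _) (Set.empty_subset _)
    have h2 : closedEdges U wired ∅ ∪ ∅ = ∅ := by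
      ext e
      simp [closedEdges, wired]
    rw [h2, numComponents_empty hU', Set.union_empty] at h1
    rw [kappa, coe_empty, h1]
  have hwired : partitionFunction p q U wired = p ^ #E * q * xi w E := by
    have h1 := finsum_weight_Cl (C := ∅) (p := p) (q := q) hU hU' hE
      (by simp [plaqClosure]) hcompat hp0.ne'
    rw [hkappa, card_empty, Nat.sub_zero, pow_zero, mul_one, pow_one, sdiff_empty] at h1
    have hset : {ω : Set (Sym2 Site) | ω ⊆ U.edgeSet} =
        {ω | ω ⊆ U.edgeSet ∧ ω ∈ Cl U (∅ : Finset (Sym2 Site))} := by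
      ext ω
      simp [Cl, plaqBoundary, plaqClosure]
    rw [partitionFunction, hset, h1]
  have hexp : Real.exp (-β * #F) = (1 - p) ^ #F := by
    rw [← hpβ, ← Real.exp_nat_mul, mul_comm]
  have hbd : (plaqBoundary U F).ncard = #C - #F := by
    rw [plaqBoundary, ← hC, ← coe_sdiff, Set.ncard_coe_finset, card_sdiff_of_subset hFC]
  have hsum := sum_interaction (b := -Real.log p) hw E F C U.edgeSet_subset hE rfl hC
  have hxE := xi_pos hw E
  have hxC := xi_pos hw (E \ C)
  have hexp' : Real.exp (∑ f ∈ F, interaction w (-Real.log p) f F U.edgeSet) =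
      (p ^ #C)⁻¹ * xi w (E \ C) / xi w E := by
    rw [hsum, Real.exp_sub, Real.exp_add, Real.exp_log hxE, Real.exp_log hxC, mul_neg,
      Real.exp_neg, Real.exp_nat_mul, Real.exp_log hp0]
  have hcard : #E - #F + #C = #E + (#C - #F) := by
    have h1 := card_le_card hCE
    have h2 := card_le_card hFC
    omega
  have hq0 : q ≠ 0 := by positivity
  -- The constant -log p in each of the `#C` terms of the interaction compensates for splitting off
  -- p^|∂F|.
  have hpow : p ^ (#E - #F) * p ^ #C = p ^ #E * p ^ (#C - #F) := by
    rw [← pow_add, ← pow_add, hcard]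
  rw [prob, hnum, hwired, hbd, Set.ncard_coe_finset, finsum_mem_coe_finset, hexp, hexp',
    zpow_sub_one₀ hq0, zpow_natCast]
  have hpC : p ^ (#E - #F) = p ^ #E * p ^ (#C - #F) * (p ^ #C)⁻¹ := by
    rw [← hpow, mul_inv_cancel_right₀ (by positivity)]
  rw [hpC]
  generalize xi w (E \ C) = X at *
  generalize xi w E = Y at *
  generalize partitionFunction p q U η = Z
  generalize (p ^ #C)⁻¹ = d
  have hY : Y * Y⁻¹ = 1 := mul_inv_cancel₀ hxE.ne'
  have hqq : q * q⁻¹ = 1 := mul_inv_cancel₀ hq0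
  simp only [div_eq_mul_inv]
  calc _ = p ^ #E * p ^ (#C - #F) * d * (1 - p) ^ #F * q ^ kappa U η F * X * Z⁻¹ *
        (q * q⁻¹) * (Y * Y⁻¹) := by rw [hY, hqq, mul_one, mul_one]
    _ = _ := by ring

/-- Uniform bounds at low temperature in terms of `u = exp (-β / 8)`. -/
lemma exists_lowTemperature_bounds (M : ℕ) (hM : 1 ≤ M) {q : ℝ} (hq : 1 ≤ q) :
    ∃ β₀ : ℝ, 0 < β₀ ∧ ∀ β : ℝ, β₀ ≤ β → ∀ u y : ℝ, u = Real.exp (-β / 8) →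
      y = Real.exp (-β) / (1 - Real.exp (-β)) * q →
      0 < u ∧ u ≤ 1 / 4 ∧ M * u ≤ 1 ∧ 0 ≤ y ∧ 2 ^ M * (2 * M * y) ≤ u ^ 4 ∧
        M * (|-Real.log (1 - Real.exp (-β))| + 2 ^ M * y) ≤ u ^ 7 := by
  have hM' : (1 : ℝ) ≤ M := by exact_mod_cast hM
  have h2M : (2 : ℝ) ≤ 2 ^ M := by
    calc (2 : ℝ) = 2 ^ 1 := by norm_num
      _ ≤ 2 ^ M := pow_le_pow_right₀ one_le_two hM
  set A : ℝ := 2 ^ M * (4 * M) * q with hA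
  have hMq : 1 ≤ M * q := by nlinarith
  have hA' : A = 4 * 2 ^ M * (M * q) := by rw [hA]; ring
  have hA4 : 4 * 2 ^ M ≤ A := by rw [hA']; nlinarith
  have hAM : (M : ℝ) ≤ A := by
    -- `A` dominates every prefactor below, so a single inequality A u ≤ 1 trades it for one power
    -- of u.
    rw [hA]
    nlinarith [mul_nonneg (by linarith : (0 : ℝ) ≤ 2 ^ M - 2) (by linarith : (0 : ℝ) ≤ M),
      mul_nonneg (by positivity : (0 : ℝ) ≤ 2 ^ M * (4 * M)) (by linarith : (0 : ℝ) ≤ q - 1)]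
  -- For β ≥ 8A one has A ≤ exp (β / 8), which is A u ≤ 1.
  refine ⟨8 * A, by linarith, fun β hβ u y hu hy => ?_⟩
  have hu0 : 0 < u := hu ▸ Real.exp_pos _
  have hAu : A * u ≤ 1 := by
    have h1 : A ≤ Real.exp (β / 8) := by
      linarith [Real.add_one_le_exp (β / 8)]
    calc A * u ≤ Real.exp (β / 8) * u := by gcongr
      _ = 1 := by rw [hu, ← Real.exp_add]; ring_nf; exact Real.exp_zero
  have hu4 : u ≤ 1 / 4 := by nlinarith
  have hexp : Real.exp (-β) = u ^ 8 := by
    rw [hu, ← Real.exp_nat_mul]; congr 1; push_cast; ring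
  rw [hexp] at hy ⊢
  have hu8 : u ^ 8 ≤ 1 / 2 := by
    calc u ^ 8 ≤ u ^ 1 := pow_le_pow_of_le_one hu0.le (by linarith) (by norm_num)
      _ ≤ 1 / 2 := by linarith
  have hu8' : 0 < u ^ 8 := by positivity
  have hdiv : u ^ 8 / (1 - u ^ 8) ≤ 2 * u ^ 8 := by
    rw [div_le_iff₀ (by linarith)]
    nlinarith
  have hy0 : 0 ≤ y := by
    rw [hy]
    have : 0 < 1 - u ^ 8 := by linarith
    positivity
  have hyu : y ≤ 2 * q * u ^ 8 := by
    rw [hy]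
    nlinarith
  have hu7 : A * u ^ 8 ≤ u ^ 7 := by
    calc A * u ^ 8 = A * u * u ^ 7 := by ring
      _ ≤ 1 * u ^ 7 := by gcongr
      _ = u ^ 7 := one_mul _
  refine ⟨hu0, hu4, (by gcongr : M * u ≤ A * u).trans hAu, hy0, ?_, ?_⟩
  · calc (2 : ℝ) ^ M * (2 * M * y) ≤ 2 ^ M * (2 * M * (2 * q * u ^ 8)) := by gcongr
      _ = A * u ^ 8 := by rw [hA]; ring
      _ ≤ u ^ 7 := hu7
      _ ≤ u ^ 4 := pow_le_pow_of_le_one hu0.le (by linarith) (by norm_num)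
  · have hlog : |-Real.log (1 - u ^ 8)| ≤ 2 * u ^ 8 := by
      rw [abs_neg, abs_of_nonpos (Real.log_nonpos (by linarith) (by linarith)), ← Real.log_inv]
      refine (Real.log_le_sub_one_of_pos (inv_pos.2 (by linarith))).trans ?_
      refine le_trans (le_of_eq ?_) hdiv
      have : 1 - u ^ 8 ≠ 0 := by linarith
      field_simp
      ring
    calc (M : ℝ) * (|-Real.log (1 - u ^ 8)| + 2 ^ M * y)
        ≤ M * (2 * u ^ 8 + 2 ^ M * (2 * q * u ^ 8)) := by gcongr
      _ = (2 * M + 2 ^ M * (2 * M) * q) * u ^ 8 := by ring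
      _ ≤ A * u ^ 8 := by
        gcongr
        rw [hA]
        nlinarith [mul_nonneg (by linarith : (0 : ℝ) ≤ 2 ^ M - 2)
          (by linarith : (0 : ℝ) ≤ M * q), mul_nonneg (by linarith : (0 : ℝ) ≤ M)
          (by linarith : (0 : ℝ) ≤ q - 1)]
      _ ≤ u ^ 7 := hu7

end RandomCluster

end

/-! ### Choice of K and g, and verification of the three properties. -/

open RandomCluster Polymer

theorem proposition4p2 :
    ∃ K : ℝ, 0 < K ∧ ∀ q : ℝ, 1 ≤ q → ∃ β₀ : ℝ, 0 < β₀ ∧ ∀ β : ℝ, β₀ ≤ β →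
      ∃ g : Sym2 RandomCluster.Site → Set (Sym2 RandomCluster.Site) →
          RandomCluster.cubicLattice.Subgraph → ℝ,
        (∀ (F : Set (Sym2 RandomCluster.Site)) (f : Sym2 RandomCluster.Site)
            (U : RandomCluster.cubicLattice.Subgraph),
          F ⊆ RandomCluster.cubicLattice.edgeSet → f ∈ F →
            |g f F U| ≤ Real.exp (-β / K)) ∧
        (∀ (F F' : Set (Sym2 RandomCluster.Site)) (f f' : Sym2 RandomCluster.Site)
            (U U' : RandomCluster.cubicLattice.Subgraph) (r : ℝ),
          F ⊆ RandomCluster.cubicLattice.edgeSet → F' ⊆ RandomCluster.cubicLattice.edgeSet →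
          f ∈ F → f' ∈ F' → 0 ≤ r →
          (r = 0 ∨ RandomCluster.LocallyCongruent r f F U f' F' U') →
            |g f F U - g f' F' U'| ≤ Real.exp (-β * r / K)) ∧
        (∀ (U : RandomCluster.cubicLattice.Subgraph) (η F : Set (Sym2 RandomCluster.Site)),
          U.verts.Finite → U.verts.Nonempty → RandomCluster.Compatible U η F →
            RandomCluster.prob (1 - Real.exp (-β)) q U η (RandomCluster.Cl U F) =
              RandomCluster.partitionFunction (1 - Real.exp (-β)) q U RandomCluster.wired /
                  RandomCluster.partitionFunction (1 - Real.exp (-β)) q U η *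
                (1 - Real.exp (-β)) ^ (RandomCluster.plaqBoundary U F).ncard *
                Real.exp (-β * F.ncard) *
                q ^ ((RandomCluster.kappa U η F : ℤ) - 1) *
                Real.exp (∑ᶠ f ∈ F, g f F U)) := by
  obtain ⟨M, hM⟩ := exists_card_nbhd_le
  have hM1 : 1 ≤ M := (Finset.card_pos.2 ⟨s(0, 0), isNbhd_nbhd.self_mem _⟩).trans_le (hM s(0, 0))
  -- With K = 8 the target rate is u = exp (-β / 8) per unit distance. The decay estimate holds with
  -- θ = u^4, leaving room for constants and rounding.
  refine ⟨8, by norm_num, fun q hq => ?_⟩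
  obtain ⟨β₀, hβ₀, hbounds⟩ := exists_lowTemperature_bounds M hM1 hq
  refine ⟨β₀, hβ₀, fun β hβ => ?_⟩
  have hβ0 : 0 < β := hβ₀.trans_le hβ
  set s := Real.exp (-β) / (1 - Real.exp (-β))
  set b := -Real.log (1 - Real.exp (-β))
  obtain ⟨hu0, hu4, hMu, hy, hyu, hb⟩ := hbounds β hβ (Real.exp (-β / 8)) (s * q) rfl rfl
  set u := Real.exp (-β / 8) with hu
  have hpow : ∀ n : ℕ, ∀ t : ℝ, t ≤ n → u ^ n ≤ Real.exp (-β * t / 8) := by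
    intro n t ht
    rw [hu, ← Real.exp_nat_mul, Real.exp_le_exp]
    nlinarith
  have hM1' : (1 : ℝ) ≤ M := by exact_mod_cast hM1
  have hu1 : u ≤ 1 := by linarith
  have hθ1 : u ^ 4 ≤ 1 := pow_le_one₀ hu0.le hu1
  have hy1 : 2 ^ M * (s * q) ≤ 1 := by
    refine le_trans ?_ (hyu.trans hθ1)
    exact mul_le_mul_of_nonneg_left (le_mul_of_one_le_left hy (by linarith)) (by positivity)
  have hs : 0 ≤ s := div_nonneg (Real.exp_pos _).le
    (sub_nonneg.2 (Real.exp_le_one_iff.2 (by linarith)))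
  have hw : IsMultiplicative nbhd (polymerWeight s q) :=
    isMultiplicative_polymerWeight hs (by linarith)
  have hwy := polymerWeight_le hs hq
  have hg : ∀ f F E, |interaction (polymerWeight s q) b f F E| ≤ u ^ 7 := fun f F E =>
    (abs_interaction_le hM hw hy hy1 hwy f F E).trans hb
  refine ⟨fun f F U => interaction (polymerWeight s q) b f F U.edgeSet, ?_, ?_, ?_⟩
  · intro F f U _ _
    have := hpow 7 1 (by norm_num)
    rw [mul_one] at this
    exact (hg f F _).trans this
  · intro F F' f f' U U' r hF hF' _ _ hr hcong
    -- Short distances, including r = 0, need only the uniform bound: 2 u^7 ≤ u^6.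
    by_cases hr6 : r ≤ 6
    · refine le_trans ?_ (hpow 6 r (by exact_mod_cast hr6))
      refine (abs_sub _ _).trans ((add_le_add (hg _ _ _) (hg _ _ _)).trans ?_)
      have : 0 < u ^ 6 := by positivity
      calc u ^ 7 + u ^ 7 = 2 * u * u ^ 6 := by ring
        _ ≤ 1 * u ^ 6 := by gcongr; linarith
        _ = u ^ 6 := one_mul _
    · rw [not_le] at hr6
      obtain ⟨t, rfl, -, hloc⟩ := hcong.resolve_left (by linarith)
      obtain ⟨n, hn1, hn2⟩ : ∃ n : ℕ, (n : ℝ) + 2 ≤ r ∧ r < n + 3 :=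
        ⟨⌊r - 2⌋₊, by linarith [Nat.floor_le (by linarith : 0 ≤ r - 2)],
          by linarith [Nat.lt_floor_add_one (r - 2)]⟩
      -- Pulling the second system back by the translation lets both interactions be compared at the
      -- same plaquette.
      have hpre : ∀ S : Set (Sym2 Site),
          translateEquiv t '' (translateEquiv t ⁻¹' S) = S := fun S =>
        Set.image_preimage_eq S (translateEquiv t).surjective
      have himg := interaction_image (b := b) t (polymerWeight_translate s q t) f
        (translateEquiv t ⁻¹' F') (translateEquiv t ⁻¹' U'.edgeSet)
      rw [hpre, hpre] at himg
      change |_ - interaction (polymerWeight s q) b (translateEquiv t f) F' U'.edgeSet| ≤ _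
      rw [himg]
      have hagree : ∀ e, dist (center f) (center e) ≤ r →
          (e ∈ U.edgeSet ↔ translateEquiv t e ∈ U'.edgeSet) ∧
            (e ∈ F ↔ translateEquiv t e ∈ F') := by
        intro e he
        by_cases hel : e ∈ cubicLattice.edgeSet
        · exact hloc e hel (by rwa [Metric.mem_closedBall, dist_comm])
        -- Local congruence speaks only of lattice edges; any other pair of sites lies in none of
        -- the sets.
        · have hel' := mt (translateEquiv_mem_edgeSet_iff t).1 hel
          exact ⟨iff_of_false (fun h => hel (U.edgeSet_subset h))
            (fun h => hel' (U'.edgeSet_subset h)),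
            iff_of_false (fun h => hel (hF h)) (fun h => hel' (hF' h))⟩
      refine (abs_interaction_sub_le hM hw hy hy1 hwy (by positivity) hθ1 hyu n hn1
        (fun e he => (hagree e he).1) (fun e he => (hagree e he).2)).trans ?_
      have hn4 : 1 ≤ 4 * n := by
        have : (3 : ℝ) < n := by linarith
        have : 3 < n := by exact_mod_cast this
        omega
      -- One power of u pays for the factor M. The exponent 4n - 1 still exceeds r, because r < n +
      -- 3 and n > 3.
      refine le_trans ?_ (hpow (4 * n - 1) r ?_)
      · calc M * (u ^ 4) ^ n = M * u * u ^ (4 * n - 1) := by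
              rw [← pow_mul, mul_assoc, ← pow_succ', Nat.sub_add_cancel hn4]
          _ ≤ 1 * u ^ (4 * n - 1) := by gcongr
          _ = _ := one_mul _
      · rw [Nat.cast_sub hn4]
        push_cast
        linarith
  · intro U η F hU hU' h
    exact prob_Cl_eq hU hU' h hβ0 hq
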